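/- **Model.** A system has $N$ identical servers, each with its own first-come-first-served queue and an unlimited buffer. Jobs arrive according to a Poisson process of rate $N\lambda/k$; each job consists of $k$ tasks, and task service times are independent and exponentially distributed with rate $1$. The load is $\lambda=1-\beta N^{-\alpha}$ with constants $0<\beta\le 1$ and $0<\alpha<1/2$. When a job arrives, $kd$ distinct queues are sampled uniformly at random (where $kd$ is a positive integer with $kd\le N$; $d$ is the probe overhead) and the batch-filling policy is applied: the $k$ tasks are assigned one by one, each to a shortest queue among the sampled ones, the queue lengths being updated after each assignment (ties are broken arbitrarily). The delay $T$ of a job is the time from its arrival until all of its tasks are completed; its inherent delay $T^*$ is the maximum of the service times of its $k$ tasks. In steady state, i.e. for a job that arrives to a system whose queue lengths follow a stationary distribution of the queue-length Markov chain, *zero queueing delay* means $\mathbb{E}[T-T^*]/\mathbb{E}[T^*]\to 0$ as $N\to\infty$. Here $k=k(N)$ and $d=d(N)$, and all asymptotics are as $N\to\infty$. **Theorem.** Assume that $k=e^{o(\sqrt{\log N})}$ and $k\to\infty$. 1. If $d=e^{o(\log N/\log k)}$, then for all sufficiently large $N$ the queue-length Markov chain has a stationary distribution, and the steady-state job delay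 satisfies $$\mathbb{E}[T]\ge 2\ln k .$$ 2. Consequently, zero queueing delay requires a probe overhead of at least $e^{\Omega(\log N/\log k)}$: for any choice of $d=d(N)$ for which zero queueing delay is achieved in steady state, there is a constant $c>0$ such that $d\ge e^{c\log N/\log k}$ for all sufficiently large $N$. -/

import Mathlib

open Filter Topology MeasureTheory ProbabilityTheory Asymptotics
open scoped ENNReal

noncomputable section

/-- `f = e^{o(g)}` as `N → ∞`. -/
def IsExpLittleO (f g : ℕ → ℝ) : Prop :=
  ∃ e : ℕ → ℝ, e =o[atTop] g ∧ ∀ᶠ N in atTop, f N = Real.exp (e N)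

/-- The load `λ = 1 - β N^{-α}`. -/
def load (α β : ℝ) (N : ℕ) : ℝ := 1 - β * (N : ℝ) ^ (-α)

/-- Numbers of tasks (the one in service included) at each of `N` servers with unlimited buffers. -/
abbrev QueueState (N : ℕ) : Type := Fin N → ℕ

/-- The length of queue `i` when task `j` of a job is about to be assigned, if the job found the
queues in state `q` and task `l` of the job is sent to server `a l`: the tasks are assigned in the
order `0, 1, …, k - 1`. -/
def lengthBefore {N k : ℕ} (q : QueueState N) (a : Fin k → Fin N) (j : Fin k) (i : Fin N) : ℕ :=
  q i + (Finset.univ.filter fun l : Fin k => l < j ∧ a l = i).card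

/-- The state right after all tasks of a job have been assigned according to `a`. -/
def stateAfter {N k : ℕ} (q : QueueState N) (a : Fin k → Fin N) : QueueState N :=
  fun i => q i + (Finset.univ.filter fun l : Fin k => a l = i).card

/-- The assignment `a` fills the sampled set `A` of queues task by task: each task joins a queue
that is shortest in `A` at that moment, queue lengths being updated after each task. -/
def IsBatchFilled {N k : ℕ} (q : QueueState N) (A : Finset (Fin N)) (a : Fin k → Fin N) : Prop :=
  ∀ j : Fin k, a j ∈ A ∧ ∀ i ∈ A, lengthBefore q a j (a j) ≤ lengthBefore q a j i

/-- A version of the batch-filling policy. Batch-filling determines the assignment up to ties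
between shortest queues; `prob q A` is the distribution of the assignment given the state `q` and
the sampled set `A`, so ties may be broken in any, possibly random, way. -/
structure BatchFilling (N k : ℕ) where
  prob : QueueState N → Finset (Fin N) → (Fin k → Fin N) → ℝ≥0∞
  sum_prob : ∀ q A, A.Nonempty → ∑ a, prob q A a = 1
  isBatchFilled : ∀ q A, A.Nonempty → ∀ a, prob q A a ≠ 0 → IsBatchFilled q A a

/-- The mean of `F` over the assignment of a job that finds the state `q`, when `m` queues
are sampled uniformly at random without replacement and are then batch-filled. -/
def assignMean {N k : ℕ} (P : BatchFilling N k) (m : ℕ) (q : QueueState N)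
    (F : (Fin k → Fin N) → ℝ≥0∞) : ℝ≥0∞ :=
  ∑ A ∈ Finset.powersetCard m (Finset.univ : Finset (Fin N)),
    (N.choose m : ℝ≥0∞)⁻¹ * ∑ a, P.prob q A a * F a

/-- Transition rates of the continuous-time Markov chain of queue lengths: jobs of `k` tasks arrive
at rate `N * lam / k`, and every busy server completes a task at rate `1`. -/
def transitionRate {N k : ℕ} (P : BatchFilling N k) (m : ℕ) (lam : ℝ) (q q' : QueueState N) :
    ℝ≥0∞ :=
  ENNReal.ofReal (N * lam / k) * assignMean P m q (fun a => if stateAfter q a = q' then 1 else 0)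
    + ∑ i : Fin N, if 0 < q i ∧ Function.update q i (q i - 1) = q' then 1 else 0

/-- `π` is a stationary distribution of the (bounded-rate) chain: the global balance equations. -/
def IsStationaryDist {N k : ℕ} (P : BatchFilling N k) (m : ℕ) (lam : ℝ) (π : PMF (QueueState N)) :
    Prop :=
  ∀ q, ∑' q', π q * transitionRate P m lam q q' = ∑' q', π q' * transitionRate P m lam q' q

/-- Joint law of the independent rate-`1` exponential (residual) service times; the coordinate
`(i, p)` belongs to the task with exactly `p` tasks ahead of it in queue `i` at the time when a
tagged job has just been assigned. -/
def serviceLaw (N : ℕ) : Measure (Fin N × ℕ → ℝ) :=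
  Measure.infinitePi fun _ => expMeasure 1

/-- The delay `T` of a job that finds the state `q` and is assigned according to `a`, for the
service times `w`: servers are first-come-first-served, so a task completes when it and all tasks
ahead of it in its queue have been served, and the job completes with its last task. -/
def jobDelay {N k : ℕ} (q : QueueState N) (a : Fin k → Fin N) (w : Fin N × ℕ → ℝ) : ℝ :=
  ⨆ j : Fin k, ∑ p ∈ Finset.range (lengthBefore q a j (a j) + 1), w (a j, p)

/-- The inherent delay `T*` of that job: the maximum of the service times of its own tasks. -/
def inherentDelay {N k : ℕ} (q : QueueState N) (a : Fin k → Fin N) (w : Fin N × ℕ → ℝ) : ℝ :=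
  ⨆ j : Fin k, w (a j, lengthBefore q a j (a j))

/-- The expectation of (the nonnegative quantity) `F` for a job that arrives when the
queues are distributed according to `π`. -/
def jobMean {N k : ℕ} (P : BatchFilling N k) (m : ℕ) (π : PMF (QueueState N))
    (F : QueueState N → (Fin k → Fin N) → (Fin N × ℕ → ℝ) → ℝ) : ℝ≥0∞ :=
  ∑' q, π q * assignMean P m q (fun a => ∫⁻ w, ENNReal.ofReal (F q a w) ∂serviceLaw N)

/-- Zero queueing delay: `E[T - T*] / E[T*] → 0` as `N → ∞`. (`T ≥ T*` almost surely.) -/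
def ZeroQueueingDelay (k m : ℕ → ℕ) (P : ∀ N, BatchFilling N (k N))
    (π : ∀ N, PMF (QueueState N)) : Prop :=
  Tendsto (fun N =>
      jobMean (P N) (m N) (π N) (fun q a w => jobDelay q a w - inherentDelay q a w) /
        jobMean (P N) (m N) (π N) inherentDelay)
    atTop (𝓝 0)

end

/-! Fix a level `h`. In steady state, tasks with fewer than `h` tasks ahead of them appear through
arrivals at the same mean rate as they disappear through departures from the busy servers with at
most `h` tasks. For `h → ∞` this bounds the mean number of idle servers by `N (1 - λ)`. An arriving
job can create such a task only if one of its `m` sampled queues is shorter than `h`, so the mean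
numbers `x h` of queues shorter than `h` satisfy `x (h + 1) ≤ x 1 + m x h`, and therefore
`m x h ≤ (m + 1) ^ h N (1 - λ)`. Since `m x h / N` bounds the probability that a job samples a queue
shorter than `h`, a job has mean delay at least `h (1 - (m + 1) ^ h (1 - λ))`. For `h` slightly
above `3 log k` and `m = k e^{o(log N / log k)}`, the power `(m + 1) ^ h` is at most a small power
of `N`, because `log² k = o(log N)`; hence a mean delay of at least `2 log k`. The mean inherent
delay is at most `log k + 1`, so such a system does not have zero queueing delay.

A stationary distribution exists by Foster's criterion: up to a constant, the queues that
batch-filling selects are no longer on average than the sampled ones, so the sum of the squared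
queue lengths has negative drift outside a finite set when `λ < 1`. -/

section PMFMean

variable {S T : Type*}

/-- The mean of a nonnegative function under a discrete distribution. -/
noncomputable def pmfMean (μ : PMF S) (f : S → ℝ≥0∞) : ℝ≥0∞ := ∑' x, μ x * f x

lemma pmfMean_const (μ : PMF S) (c : ℝ≥0∞) : pmfMean μ (fun _ => c) = c := by
  rw [pmfMean, ENNReal.tsum_mul_right, μ.tsum_coe, one_mul]

lemma pmfMean_add (μ : PMF S) (f g : S → ℝ≥0∞) :
    pmfMean μ (fun x => f x + g x) = pmfMean μ f + pmfMean μ g := by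
  simp only [pmfMean, mul_add, ENNReal.tsum_add]

lemma pmfMean_const_mul (μ : PMF S) (c : ℝ≥0∞) (f : S → ℝ≥0∞) :
    pmfMean μ (fun x => c * f x) = c * pmfMean μ f := by
  simp only [pmfMean, mul_left_comm _ c, ENNReal.tsum_mul_left]

lemma pmfMean_mono (μ : PMF S) {f g : S → ℝ≥0∞} (h : ∀ x, f x ≤ g x) :
    pmfMean μ f ≤ pmfMean μ g :=
  ENNReal.tsum_le_tsum fun x => mul_le_mul_right (h x) _

lemma pmfMean_pure (x : S) (f : S → ℝ≥0∞) : pmfMean (PMF.pure x) f = f x := by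
  rw [pmfMean, tsum_eq_single x fun y hy => by simp [PMF.pure_apply, hy]]
  simp

lemma pmfMean_bind (μ : PMF S) (p : S → PMF T) (f : T → ℝ≥0∞) :
    pmfMean (μ.bind p) f = pmfMean μ fun x => pmfMean (p x) f := by
  simp only [pmfMean, PMF.bind_apply, ← ENNReal.tsum_mul_right, ← ENNReal.tsum_mul_left]
  rw [ENNReal.tsum_comm]
  simp only [mul_assoc]

lemma pmfMean_uniformOfFinset {s : Finset S} (hs : s.Nonempty) (f : S → ℝ≥0∞) :
    pmfMean (PMF.uniformOfFinset s hs) f = (s.card : ℝ≥0∞)⁻¹ * ∑ x ∈ s, f x := by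
  rw [pmfMean, tsum_eq_sum (s := s) fun x hx => by
      rw [PMF.uniformOfFinset_apply_of_notMem hs hx, zero_mul], Finset.mul_sum]
  exact Finset.sum_congr rfl fun x hx => by rw [PMF.uniformOfFinset_apply_of_mem hs hx]

lemma pmfMean_le_of_eventually_le {μ : PMF S} {F : ℕ → S → ℝ≥0∞} {f : S → ℝ≥0∞} {B : ℝ≥0∞}
    (hF : ∀ x, ∀ᶠ n in atTop, f x ≤ F n x) (hB : ∀ n, pmfMean μ (F n) ≤ B) :
    pmfMean μ f ≤ B := by
  refine ENNReal.summable.tsum_le_of_sum_le fun s => ?_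
  obtain ⟨n, hn⟩ := ((Finset.eventually_all s).2 fun x _ => hF x).exists
  calc ∑ x ∈ s, μ x * f x ≤ ∑ x ∈ s, μ x * F n x := by
        gcongr with x hx
        exact hn x hx
    _ ≤ pmfMean μ (F n) := ENNReal.sum_le_tsum s
    _ ≤ B := hB n

lemma le_mul_sum_add_pmfMean (μ : PMF S) {W : S → ℝ≥0∞} {c : ℝ≥0∞} {F : Finset S}
    (hF : ∀ x ∉ F, c ≤ W x) : c ≤ c * ∑ x ∈ F, μ x + pmfMean μ W := by
  classical
  calc c = pmfMean μ fun _ => c := (pmfMean_const μ c).symm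
    _ ≤ pmfMean μ fun x => c * (if x ∈ F then 1 else 0) + W x := by
        refine pmfMean_mono μ fun x => ?_
        by_cases hx : x ∈ F
        · simp [hx]
        · simpa [hx] using hF x hx
    _ = c * ∑ x ∈ F, μ x + pmfMean μ W := by
        rw [pmfMean_add, pmfMean_const_mul]
        congr 2
        rw [pmfMean, tsum_eq_sum (s := F) fun x hx => by simp [hx]]
        exact Finset.sum_congr rfl fun x hx => by simp [hx]

lemma pmf_eq_of_le {μ ν : PMF S} (h : ∀ x, μ x ≤ ν x) : μ = ν := by
  refine PMF.ext fun x => (h x).antisymm (not_lt.1 fun hx => ?_)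
  have hlt := ENNReal.tsum_lt_tsum μ.tsum_coe_ne_top h hx
  rw [μ.tsum_coe, ν.tsum_coe] at hlt
  exact lt_irrefl _ hlt

end PMFMean

section Foster

variable {S : Type*} {V W : S → ℝ≥0∞} {B C : ℝ≥0∞}

/-- The law after `n` steps of the Markov chain with kernel `p` started at `x₀`. -/
noncomputable def lawAt (p : S → PMF S) (x₀ : S) (n : ℕ) : PMF S :=
  (fun μ : PMF S => μ.bind p)^[n] (PMF.pure x₀)

/-- The law of the chain at an independent time that is uniform on `0, …, n`. -/
noncomputable def averageLaw (p : S → PMF S) (x₀ : S) (n : ℕ) : PMF S :=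
  (PMF.uniformOfFinset (Finset.range (n + 1)) Finset.nonempty_range_add_one).bind (lawAt p x₀)

variable {p : S → PMF S}

lemma lawAt_succ (p : S → PMF S) (x₀ : S) (n : ℕ) :
    lawAt p x₀ (n + 1) = (lawAt p x₀ n).bind p :=
  Function.iterate_succ_apply' _ _ _

lemma pmfMean_averageLaw (p : S → PMF S) (x₀ : S) (n : ℕ) (f : S → ℝ≥0∞) :
    pmfMean (averageLaw p x₀ n) f =
      ((n + 1 : ℕ) : ℝ≥0∞)⁻¹ * ∑ j ∈ Finset.range (n + 1), pmfMean (lawAt p x₀ j) f := by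
  rw [averageLaw, pmfMean_bind, pmfMean_uniformOfFinset, Finset.card_range]

lemma averageLaw_apply (p : S → PMF S) (x₀ : S) (n : ℕ) (x : S) :
    averageLaw p x₀ n x =
      ((n + 1 : ℕ) : ℝ≥0∞)⁻¹ * ∑ j ∈ Finset.range (n + 1), lawAt p x₀ j x := by
  rw [averageLaw, PMF.bind_apply, ← pmfMean, pmfMean_uniformOfFinset, Finset.card_range]

lemma pmfMean_lawAt_add_sum_le (hdrift : ∀ x, pmfMean (p x) V + W x ≤ V x + C) (x₀ : S) (n : ℕ) :
    pmfMean (lawAt p x₀ n) V + ∑ j ∈ Finset.range n, pmfMean (lawAt p x₀ j) W ≤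
      V x₀ + n * C := by
  induction n with
  | zero => simp [lawAt, pmfMean_pure]
  | succ n ih =>
    have hstep : pmfMean (lawAt p x₀ (n + 1)) V + pmfMean (lawAt p x₀ n) W ≤
        pmfMean (lawAt p x₀ n) V + C := by
      rw [lawAt_succ, pmfMean_bind, ← pmfMean_add]
      exact (pmfMean_mono _ hdrift).trans_eq (by rw [pmfMean_add, pmfMean_const])
    rw [Finset.sum_range_succ]
    set s := ∑ j ∈ Finset.range n, pmfMean (lawAt p x₀ j) W
    calc pmfMean (lawAt p x₀ (n + 1)) V + (s + pmfMean (lawAt p x₀ n) W)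
        = pmfMean (lawAt p x₀ (n + 1)) V + pmfMean (lawAt p x₀ n) W + s := by ring
      _ ≤ pmfMean (lawAt p x₀ n) V + C + s := by gcongr
      _ = pmfMean (lawAt p x₀ n) V + s + C := by ring
      _ ≤ V x₀ + n * C + C := by gcongr
      _ = V x₀ + (n + 1 : ℕ) * C := by push_cast; ring

lemma pmfMean_averageLaw_le (hdrift : ∀ x, pmfMean (p x) V + W x ≤ V x + C) (x₀ : S) (n : ℕ) :
    pmfMean (averageLaw p x₀ n) W ≤ V x₀ + C := by
  rw [pmfMean_averageLaw, mul_comm, ← div_eq_mul_inv]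
  refine ENNReal.div_le_of_le_mul ?_
  calc ∑ j ∈ Finset.range (n + 1), pmfMean (lawAt p x₀ j) W
      ≤ V x₀ + (n + 1 : ℕ) * C := le_add_self.trans (pmfMean_lawAt_add_sum_le hdrift x₀ (n + 1))
    _ ≤ (n + 1 : ℕ) * V x₀ + (n + 1 : ℕ) * C := by
        gcongr
        exact le_mul_of_one_le_left' (by simp)
    _ = (V x₀ + C) * (n + 1 : ℕ) := by ring

lemma averageLaw_bind_le (p : S → PMF S) (x₀ : S) (n : ℕ) (y : S) :
    (averageLaw p x₀ n).bind p y ≤ averageLaw p x₀ n y + ((n + 1 : ℕ) : ℝ≥0∞)⁻¹ := by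
  calc (averageLaw p x₀ n).bind p y
      = ((n + 1 : ℕ) : ℝ≥0∞)⁻¹ * ∑ j ∈ Finset.range (n + 1), lawAt p x₀ (j + 1) y := by
        simp only [lawAt_succ, PMF.bind_apply]
        exact pmfMean_averageLaw p x₀ n fun x => p x y
    _ ≤ ((n + 1 : ℕ) : ℝ≥0∞)⁻¹ * (∑ j ∈ Finset.range (n + 1), lawAt p x₀ j y + 1) := by
        gcongr
        calc ∑ j ∈ Finset.range (n + 1), lawAt p x₀ (j + 1) y
            ≤ ∑ j ∈ Finset.range (n + 1), lawAt p x₀ (j + 1) y + lawAt p x₀ 0 y := le_self_add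
          _ = ∑ j ∈ Finset.range (n + 1), lawAt p x₀ j y + lawAt p x₀ (n + 1) y := by
              rw [← Finset.sum_range_succ' (fun j => lawAt p x₀ j y), Finset.sum_range_succ]
          _ ≤ _ := by gcongr; exact PMF.coe_le_one _ _
    _ = averageLaw p x₀ n y + ((n + 1 : ℕ) : ℝ≥0∞)⁻¹ := by
        rw [mul_add, mul_one, averageLaw_apply]

/-- A form of Prokhorov's theorem: no mass escapes, because `W` has finite sublevel sets. -/
lemma exists_pmf_tendsto_of_pmfMean_le {ι : Type*} (U : Ultrafilter ι) {ν : ι → PMF S}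
    (hB : B ≠ ∞) (hW : ∀ c : ℝ≥0∞, c ≠ ∞ → {x | W x ≤ c}.Finite)
    (hν : ∀ n, pmfMean (ν n) W ≤ B) :
    ∃ π : PMF S, ∀ x, Tendsto (fun n => ν n x) U (𝓝 (π x)) := by
  set f : S → ℝ≥0∞ := fun x => (U.map fun n => ν n x).lim
  have hf (x : S) : Tendsto (fun n => ν n x) U (𝓝 (f x)) :=
    Ultrafilter.le_nhds_lim (U.map fun n => ν n x)
  have hfsum (F : Finset S) : Tendsto (fun n => ∑ x ∈ F, ν n x) U (𝓝 (∑ x ∈ F, f x)) :=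
    tendsto_finsetSum F fun x _ => hf x
  have hle : ∑' x, f x ≤ 1 := ENNReal.summable.tsum_le_of_sum_le fun F =>
    le_of_tendsto (hfsum F) (Eventually.of_forall fun n =>
      (ENNReal.sum_le_tsum F).trans_eq (ν n).tsum_coe)
  have htight (c : ℝ≥0∞) (hc : c ≠ ∞) : c ≤ c * ∑' x, f x + B := by
    set F := (hW c hc).toFinset
    have hmarkov (n : ι) : c ≤ c * ∑ x ∈ F, ν n x + B :=
      (le_mul_sum_add_pmfMean (ν n) fun x hx =>
        (not_le.1 fun h => hx ((hW c hc).mem_toFinset.2 h)).le).trans (by gcongr; exact hν n)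
    calc c ≤ c * ∑ x ∈ F, f x + B :=
          ge_of_tendsto ((ENNReal.Tendsto.const_mul (hfsum F) (Or.inr hc)).add_const B)
            (Eventually.of_forall hmarkov)
      _ ≤ c * ∑' x, f x + B := by gcongr; exact ENNReal.sum_le_tsum F
  have hge : 1 ≤ ∑' x, f x := by
    by_contra! hlt
    obtain ⟨c, hc⟩ := ENNReal.exists_nat_mul_gt (tsub_pos_of_lt hlt).ne' hB
    have hmass : (c : ℝ≥0∞) = c * ∑' x, f x + c * (1 - ∑' x, f x) := by
      rw [← mul_add, add_tsub_cancel_of_le hle, mul_one]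
    have hfin : (c : ℝ≥0∞) * ∑' x, f x ≠ ∞ :=
      ENNReal.mul_ne_top (ENNReal.natCast_ne_top c) (ne_top_of_le_ne_top ENNReal.one_ne_top hle)
    exact hc.not_ge ((ENNReal.add_le_add_iff_left hfin).1
      (hmass.symm.trans_le (htight c (ENNReal.natCast_ne_top c))))
  exact ⟨⟨f, hle.antisymm hge ▸ ENNReal.summable.hasSum⟩, hf⟩

lemma bind_eq_of_tendsto {ι : Type*} {l : Filter ι} [l.NeBot] {ν : ι → PMF S} {π : PMF S}
    {ε : ι → ℝ≥0∞} (hν : ∀ x, Tendsto (fun n => ν n x) l (𝓝 (π x))) (hε : Tendsto ε l (𝓝 0))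
    (h : ∀ n y, (ν n).bind p y ≤ ν n y + ε n) : π.bind p = π := by
  -- Fatou gives only one inequality, but both sides have mass one.
  refine pmf_eq_of_le fun y => ENNReal.summable.tsum_le_of_sum_le fun F => ?_
  have hlim : Tendsto (fun n => ∑ x ∈ F, ν n x * p x y) l (𝓝 (∑ x ∈ F, π x * p x y)) :=
    tendsto_finsetSum F fun x _ => ENNReal.Tendsto.mul_const (hν x) (Or.inr ((p x).apply_ne_top y))
  refine le_of_tendsto_of_tendsto' hlim (by simpa using (hν y).add hε) fun n => ?_
  exact (ENNReal.sum_le_tsum F).trans (h n y)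

/-- **Foster's criterion** in discrete time. -/
theorem exists_pmf_bind_eq (hC : C ≠ ∞) (hdrift : ∀ x, pmfMean (p x) V + W x ≤ V x + C)
    (hW : ∀ c : ℝ≥0∞, c ≠ ∞ → {x | W x ≤ c}.Finite) {x₀ : S} (hx₀ : V x₀ ≠ ∞) :
    ∃ π : PMF S, π.bind p = π := by
  obtain ⟨π, hπ⟩ := exists_pmf_tendsto_of_pmfMean_le (hyperfilter ℕ)
    (ENNReal.add_ne_top.2 ⟨hx₀, hC⟩) hW (pmfMean_averageLaw_le hdrift x₀)
  have hinv : Tendsto (fun n : ℕ => ((n + 1 : ℕ) : ℝ≥0∞)⁻¹) (hyperfilter ℕ) (𝓝 0) :=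
    (ENNReal.tendsto_inv_nat_nhds_zero.comp (tendsto_add_atTop_nat 1)).mono_left
      Nat.hyperfilter_le_atTop
  exact ⟨π, bind_eq_of_tendsto hπ hinv (averageLaw_bind_le p x₀)⟩

end Foster

section Balance

variable {S : Type*} {Q : S → S → ℝ≥0∞} {π : PMF S} {V W : S → ℝ≥0∞} {C Λ : ℝ≥0∞}

/-- The global balance equations of the continuous-time Markov chain with transition rates `Q`;
`Q x x` is unconstrained, as it appears on both sides. -/
def IsBalanced (Q : S → S → ℝ≥0∞) (π : PMF S) : Prop :=
  ∀ x, ∑' y, π x * Q x y = ∑' y, π y * Q y x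

/-- The total rate out of the state `x`. -/
noncomputable def totalRate (Q : S → S → ℝ≥0∞) (x : S) : ℝ≥0∞ := ∑' y, Q x y

lemma IsBalanced.pmfMean_totalRate_mul (hπ : IsBalanced Q π) (f : S → ℝ≥0∞) :
    pmfMean π (fun x => totalRate Q x * f x) = pmfMean π fun x => ∑' y, Q x y * f y := by
  calc pmfMean π (fun x => totalRate Q x * f x) = ∑' x, (∑' y, π x * Q x y) * f x :=
        tsum_congr fun x => by simp only [ENNReal.tsum_mul_left, mul_assoc, totalRate]
    _ = ∑' x, ∑' y, π y * (Q y x * f x) :=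
        tsum_congr fun x => by simp only [hπ x, ← ENNReal.tsum_mul_right, mul_assoc]
    _ = pmfMean π fun x => ∑' y, Q x y * f y := by
        rw [ENNReal.tsum_comm]
        simp only [ENNReal.tsum_mul_left, pmfMean]

/-- Rate conservation: if `f` increases at rate `G` and decreases at rate `L`, then `G` and `L`
have the same mean in steady state. -/
lemma IsBalanced.pmfMean_gain_eq_pmfMean_loss (hπ : IsBalanced Q π) {f G L : S → ℝ≥0∞}
    (hf : pmfMean π (fun x => totalRate Q x * f x) ≠ ∞)
    (h : ∀ x, ∑' y, Q x y * f y + L x = totalRate Q x * f x + G x) :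
    pmfMean π G = pmfMean π L := by
  have hmean : pmfMean π (fun x => ∑' y, Q x y * f y) + pmfMean π L =
      pmfMean π (fun x => totalRate Q x * f x) + pmfMean π G := by
    simp only [← pmfMean_add, h]
  rw [← hπ.pmfMean_totalRate_mul] at hmean
  exact ((ENNReal.add_right_inj hf).1 hmean).symm

/-- The jump chain of the chain with rates `Q`, uniformized at rate `Λ`. -/
noncomputable def uniformize (Q : S → S → ℝ≥0∞) (Λ : ℝ≥0∞) (x y : S) : ℝ≥0∞ :=
  open Classical in Λ⁻¹ * (Q x y + if y = x then Λ - totalRate Q x else 0)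

lemma tsum_uniformize_mul (Q : S → S → ℝ≥0∞) (Λ : ℝ≥0∞) (x : S) (f : S → ℝ≥0∞) :
    ∑' y, uniformize Q Λ x y * f y =
      Λ⁻¹ * (∑' y, Q x y * f y + (Λ - totalRate Q x) * f x) := by
  simp only [uniformize, mul_assoc, ENNReal.tsum_mul_left, add_mul, ite_mul, zero_mul,
    ENNReal.tsum_add]
  rw [tsum_eq_single x fun y hy => if_neg hy, if_pos rfl]

lemma tsum_uniformize (hΛ0 : Λ ≠ 0) (hΛ : Λ ≠ ∞) {x : S} (hx : totalRate Q x ≤ Λ) :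
    ∑' y, uniformize Q Λ x y = 1 := by
  have h := tsum_uniformize_mul Q Λ x 1
  simp only [Pi.one_apply, mul_one] at h
  rw [h, ← totalRate, add_tsub_cancel_of_le hx, ENNReal.inv_mul_cancel hΛ0 hΛ]

lemma isBalanced_of_tsum_mul_uniformize (hΛ0 : Λ ≠ 0) (hΛ : Λ ≠ ∞)
    (hQ : ∀ x, totalRate Q x ≤ Λ) (h : ∀ y, ∑' x, π x * uniformize Q Λ x y = π y) :
    IsBalanced Q π := by
  classical
  intro x
  have hstay : π x * (Λ - totalRate Q x) ≠ ∞ := ENNReal.mul_ne_top (π.apply_ne_top x)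
    (ENNReal.sub_ne_top hΛ)
  refine (ENNReal.add_left_inj hstay).1 ?_
  calc ∑' y, π x * Q x y + π x * (Λ - totalRate Q x)
      = Λ * π x := by
        rw [ENNReal.tsum_mul_left, ← totalRate, ← mul_add, add_tsub_cancel_of_le (hQ x), mul_comm]
    _ = Λ * ∑' y, Λ⁻¹ * (π y * Q y x + if y = x then π x * (Λ - totalRate Q x) else 0) := by
        conv_lhs => rw [← h x]
        congr 1
        refine tsum_congr fun y => ?_
        rcases eq_or_ne y x with rfl | hyx
        · simp only [uniformize, if_true]
          ring
        · simp only [uniformize, hyx.symm, hyx, if_false]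
          ring
    _ = ∑' y, π y * Q y x + π x * (Λ - totalRate Q x) := by
        rw [ENNReal.tsum_mul_left, ← mul_assoc, ENNReal.mul_inv_cancel hΛ0 hΛ, one_mul,
          ENNReal.tsum_add, tsum_ite_eq]

/-- **Foster's criterion** in continuous time, for bounded rates. -/
theorem exists_isBalanced (hΛ0 : Λ ≠ 0) (hΛ : Λ ≠ ∞) (hQ : ∀ x, totalRate Q x ≤ Λ) (hC : C ≠ ∞)
    (hdrift : ∀ x, ∑' y, Q x y * V y + W x ≤ totalRate Q x * V x + C)
    (hW : ∀ c : ℝ≥0∞, c ≠ ∞ → {x | W x ≤ c}.Finite) {x₀ : S} (hx₀ : V x₀ ≠ ∞) :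
    ∃ π : PMF S, IsBalanced Q π := by
  set p : S → PMF S := fun x =>
    ⟨uniformize Q Λ x, tsum_uniformize hΛ0 hΛ (hQ x) ▸ ENNReal.summable.hasSum⟩
  have hp (x : S) : pmfMean (p x) V + Λ⁻¹ * W x ≤ V x + Λ⁻¹ * C := by
    calc pmfMean (p x) V + Λ⁻¹ * W x
        = Λ⁻¹ * (∑' y, Q x y * V y + W x + (Λ - totalRate Q x) * V x) := by
          rw [show pmfMean (p x) V = _ from tsum_uniformize_mul Q Λ x V]
          ring
      _ ≤ Λ⁻¹ * (totalRate Q x * V x + C + (Λ - totalRate Q x) * V x) := by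
          exact mul_le_mul_right (add_le_add_left (hdrift x) _) _
      _ = Λ⁻¹ * ((totalRate Q x + (Λ - totalRate Q x)) * V x) + Λ⁻¹ * C := by ring
      _ = V x + Λ⁻¹ * C := by
          rw [add_tsub_cancel_of_le (hQ x), ← mul_assoc, ENNReal.inv_mul_cancel hΛ0 hΛ, one_mul]
  have hpW (c : ℝ≥0∞) (hc : c ≠ ∞) : {x | Λ⁻¹ * W x ≤ c}.Finite := by
    refine (hW (Λ * c) (ENNReal.mul_ne_top hΛ hc)).subset fun x hx => ?_
    calc W x = Λ * (Λ⁻¹ * W x) := by rw [← mul_assoc, ENNReal.mul_inv_cancel hΛ0 hΛ, one_mul]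
      _ ≤ Λ * c := mul_le_mul_right hx Λ
  obtain ⟨π, hπ⟩ := exists_pmf_bind_eq
    (ENNReal.mul_ne_top (ENNReal.inv_ne_top.2 hΛ0) hC) hp hpW hx₀
  exact ⟨π, isBalanced_of_tsum_mul_uniformize hΛ0 hΛ hQ fun y => DFunLike.congr_fun hπ y⟩

end Balance

section Exponential

variable {r t : ℝ}

lemma exponentialPDF_add_mul_ofReal (hr : 0 < r) (ht : 0 ≤ t) (y : ℝ) :
    exponentialPDF r (y + t) * ENNReal.ofReal y =
      ENNReal.ofReal (Real.exp (-(r * t)) / r) * gammaPDF 2 r y := by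
  rcases lt_or_ge y 0 with hy | hy
  · simp [gammaPDF_of_neg hy, ENNReal.ofReal_of_nonpos hy.le]
  · rw [exponentialPDF_of_nonneg (by positivity), gammaPDF_of_nonneg hy,
      ← ENNReal.ofReal_mul (by positivity), ← ENNReal.ofReal_mul (by positivity)]
    congr 1
    rw [Real.Gamma_two, show (2 : ℝ) - 1 = 1 by norm_num, mul_add, neg_add, Real.exp_add]
    simp only [Real.rpow_one, Real.rpow_two]
    field_simp

lemma lintegral_ofReal_sub_expMeasure (hr : 0 < r) (ht : 0 ≤ t) :
    ∫⁻ x, ENNReal.ofReal (x - t) ∂expMeasure r = ENNReal.ofReal (Real.exp (-(r * t)) / r) := by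
  have hpdf : Measurable (exponentialPDF r) := (measurable_exponentialPDFReal r).ennreal_ofReal
  have h : expMeasure r = volume.withDensity (exponentialPDF r) := rfl
  rw [h, lintegral_withDensity_eq_lintegral_mul _ hpdf (by fun_prop),
    ← lintegral_add_right_eq_self _ t]
  simp only [Pi.mul_apply, add_sub_cancel_right, exponentialPDF_add_mul_ofReal hr ht]
  rw [lintegral_const_mul' _ _ ENNReal.ofReal_ne_top,
    lintegral_gammaPDF_eq_one two_pos hr, mul_one]

lemma ae_nonneg_expMeasure (r : ℝ) : ∀ᵐ x ∂expMeasure r, 0 ≤ x := by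
  have h : expMeasure r = volume.withDensity (exponentialPDF r) := rfl
  rw [ae_iff, h, show {x : ℝ | ¬0 ≤ x} = Set.Iio 0 by ext; simp,
    withDensity_apply _ measurableSet_Iio]
  exact lintegral_exponentialPDF_of_nonpos le_rfl

-- Bound the maximum by `t + ∑ i, (X i - t)⁺` at the optimal level `t = log (card ι) / r`.
lemma lintegral_iSup_le_of_hasLaw_expMeasure {Ω ι : Type*} {mΩ : MeasurableSpace Ω}
    {μ : Measure Ω} [Fintype ι] [Nonempty ι] {X : ι → Ω → ℝ} (hr : 0 < r)
    (hX : ∀ i, HasLaw (X i) (expMeasure r) μ) :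
    ∫⁻ ω, ENNReal.ofReal (⨆ i, X i ω) ∂μ ≤
      ENNReal.ofReal ((Real.log (Fintype.card ι) + 1) / r) := by
  have hprob := isProbabilityMeasure_expMeasure hr
  have : IsProbabilityMeasure μ := (hX (Classical.arbitrary ι)).isProbabilityMeasure
  have hcard : (1 : ℝ) ≤ Fintype.card ι := by exact_mod_cast Fintype.card_pos
  set t := Real.log (Fintype.card ι) / r
  have ht : 0 ≤ t := div_nonneg (Real.log_nonneg hcard) hr.le
  have hexcess (i : ι) : ∫⁻ ω, ENNReal.ofReal (X i ω - t) ∂μ =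
      ENNReal.ofReal (Real.exp (-(r * t)) / r) := by
    rw [← lintegral_ofReal_sub_expMeasure hr ht, ← (hX i).lintegral_comp (by fun_prop)]
  have hsup (ω : Ω) : ENNReal.ofReal (⨆ i, X i ω) ≤
      ENNReal.ofReal t + ∑ i, ENNReal.ofReal (X i ω - t) := by
    obtain ⟨i, hi⟩ := exists_eq_ciSup_of_finite (f := fun i => X i ω)
    calc ENNReal.ofReal (⨆ i, X i ω) = ENNReal.ofReal (t + (X i ω - t)) := by
          rw [← hi, add_sub_cancel]
      _ ≤ ENNReal.ofReal t + ENNReal.ofReal (X i ω - t) := ENNReal.ofReal_add_le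
      _ ≤ _ := by
          gcongr
          exact Finset.single_le_sum (f := fun i => ENNReal.ofReal (X i ω - t))
            (fun _ _ => zero_le) (Finset.mem_univ i)
  have hexp : (Fintype.card ι : ℝ) * (Real.exp (-(r * t)) / r) = 1 / r := by
    rw [mul_div_cancel₀ _ hr.ne', Real.exp_neg, Real.exp_log (by positivity), mul_div_assoc',
      mul_inv_cancel₀ (by positivity)]
  calc ∫⁻ ω, ENNReal.ofReal (⨆ i, X i ω) ∂μ
      ≤ ∫⁻ ω, (ENNReal.ofReal t + ∑ i, ENNReal.ofReal (X i ω - t)) ∂μ := lintegral_mono hsup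
    _ = ENNReal.ofReal t + ∑ _i : ι, ENNReal.ofReal (Real.exp (-(r * t)) / r) := by
        rw [lintegral_add_left measurable_const, lintegral_const, measure_univ, mul_one,
          lintegral_finsetSum' _ fun i _ => by have := (hX i).aemeasurable; fun_prop]
        simp only [hexcess]
    _ = ENNReal.ofReal ((Real.log (Fintype.card ι) + 1) / r) := by
        rw [Finset.sum_const, Finset.card_univ, nsmul_eq_mul, ← ENNReal.ofReal_natCast,
          ← ENNReal.ofReal_mul (by positivity), hexp, ← ENNReal.ofReal_add ht (by positivity),
          add_div]

end Exponential

section Delay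

variable {N k : ℕ} (q : QueueState N) (a : Fin k → Fin N)

instance : IsProbabilityMeasure (expMeasure 1) := isProbabilityMeasure_expMeasure one_pos

instance (N : ℕ) : IsProbabilityMeasure (serviceLaw N) := by
  unfold serviceLaw
  infer_instance

lemma hasLaw_eval_serviceLaw (x : Fin N × ℕ) :
    HasLaw (fun w : Fin N × ℕ → ℝ => w x) (expMeasure 1) (serviceLaw N) :=
  (measurePreserving_eval_infinitePi (fun _ : Fin N × ℕ => expMeasure 1) x).hasLaw

lemma lintegral_eval_serviceLaw (x : Fin N × ℕ) :
    ∫⁻ w, ENNReal.ofReal (w x) ∂serviceLaw N = 1 := by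
  rw [(hasLaw_eval_serviceLaw x).lintegral_comp (f := fun y => ENNReal.ofReal y) (by fun_prop)]
  simpa using lintegral_ofReal_sub_expMeasure one_pos (t := 0) le_rfl

lemma ae_nonneg_serviceLaw (N : ℕ) : ∀ᵐ w ∂serviceLaw N, ∀ x, 0 ≤ w x :=
  ae_all_iff.2 fun x =>
    ((hasLaw_eval_serviceLaw x).ae_iff (measurableSet_setOfPred.1 measurableSet_Ici)).2
      (ae_nonneg_expMeasure 1)

lemma le_lintegral_jobDelay (j : Fin k) :
    (lengthBefore q a j (a j) + 1 : ℝ≥0∞) ≤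
      ∫⁻ w, ENNReal.ofReal (jobDelay q a w) ∂serviceLaw N := by
  set n := lengthBefore q a j (a j) + 1 with hn
  calc (lengthBefore q a j (a j) + 1 : ℝ≥0∞)
      = ∑ p ∈ Finset.range n, ∫⁻ w, ENNReal.ofReal (w (a j, p)) ∂serviceLaw N := by
        simp [lintegral_eval_serviceLaw, hn]
    _ = ∫⁻ w, ∑ p ∈ Finset.range n, ENNReal.ofReal (w (a j, p)) ∂serviceLaw N :=
        (lintegral_finsetSum _ fun p _ => by fun_prop).symm
    _ ≤ ∫⁻ w, ENNReal.ofReal (jobDelay q a w) ∂serviceLaw N := by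
        refine lintegral_mono_ae ?_
        filter_upwards [ae_nonneg_serviceLaw N] with w hw
        rw [← ENNReal.ofReal_sum_of_nonneg fun p _ => hw _]
        exact ENNReal.ofReal_le_ofReal (Finite.le_ciSup (fun j : Fin k =>
          ∑ p ∈ Finset.range (lengthBefore q a j (a j) + 1), w (a j, p)) j)

lemma lintegral_inherentDelay_le (hk : 0 < k) :
    ∫⁻ w, ENNReal.ofReal (inherentDelay q a w) ∂serviceLaw N ≤
      ENNReal.ofReal (Real.log k + 1) := by
  have : Nonempty (Fin k) := ⟨⟨0, hk⟩⟩
  simpa only [Fintype.card_fin, div_one, inherentDelay] using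
    lintegral_iSup_le_of_hasLaw_expMeasure one_pos fun j : Fin k =>
      hasLaw_eval_serviceLaw (a j, lengthBefore q a j (a j))

lemma lintegral_jobDelay_le :
    ∫⁻ w, ENNReal.ofReal (jobDelay q a w) ∂serviceLaw N ≤
      ∫⁻ w, ENNReal.ofReal (jobDelay q a w - inherentDelay q a w) ∂serviceLaw N +
        ∫⁻ w, ENNReal.ofReal (inherentDelay q a w) ∂serviceLaw N := by
  have hmeas : Measurable (inherentDelay q a) := Measurable.iSup fun j => by fun_prop
  rw [← lintegral_add_right _ hmeas.ennreal_ofReal]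
  refine lintegral_mono fun w => ?_
  calc ENNReal.ofReal (jobDelay q a w)
      = ENNReal.ofReal (jobDelay q a w - inherentDelay q a w + inherentDelay q a w) := by
        rw [sub_add_cancel]
    _ ≤ _ := ENNReal.ofReal_add_le

end Delay

section Sampling

variable {ι : Type*} [Fintype ι] {m : ℕ}

/-- The mean of `G` over a uniformly random set of `m` elements. -/
noncomputable def sampleMean (m : ℕ) (G : Finset ι → ℝ≥0∞) : ℝ≥0∞ :=
  ((Fintype.card ι).choose m : ℝ≥0∞)⁻¹ * ∑ A ∈ Finset.powersetCard m Finset.univ, G A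

lemma sampleMean_const (hm : m ≤ Fintype.card ι) (c : ℝ≥0∞) :
    sampleMean m (fun _ : Finset ι => c) = c := by
  have h : ((Fintype.card ι).choose m : ℝ≥0∞) ≠ 0 := by exact_mod_cast (Nat.choose_pos hm).ne'
  rw [sampleMean, Finset.sum_const, Finset.card_powersetCard, Finset.card_univ, nsmul_eq_mul,
    ← mul_assoc, ENNReal.inv_mul_cancel h (ENNReal.natCast_ne_top _), one_mul]

lemma sampleMean_mono {G H : Finset ι → ℝ≥0∞} (h : ∀ A, A.card = m → G A ≤ H A) :
    sampleMean m G ≤ sampleMean m H :=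
  mul_le_mul_right (Finset.sum_le_sum fun A hA => h A (Finset.mem_powersetCard.1 hA).2) _

lemma sampleMean_add (G H : Finset ι → ℝ≥0∞) :
    sampleMean m (fun A => G A + H A) = sampleMean m G + sampleMean m H := by
  rw [sampleMean, Finset.sum_add_distrib, mul_add, sampleMean, sampleMean]

lemma sampleMean_const_mul (c : ℝ≥0∞) (G : Finset ι → ℝ≥0∞) :
    sampleMean m (fun A => c * G A) = c * sampleMean m G := by
  rw [sampleMean, ← Finset.mul_sum, mul_left_comm, sampleMean]

lemma inv_choose_mul_choose {n : ℕ} (hm : 1 ≤ m) (hmn : m ≤ n) :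
    (n.choose m : ℝ≥0∞)⁻¹ * (n - 1).choose (m - 1) = m / n := by
  obtain ⟨l, rfl⟩ := Nat.exists_eq_add_of_le' hm
  obtain ⟨n, rfl⟩ := Nat.exists_eq_add_of_le' (hm.trans hmn)
  have hchoose : ((n + 1).choose (l + 1) : ℝ≥0∞) ≠ 0 := by
    exact_mod_cast (Nat.choose_pos hmn).ne'
  rw [mul_comm, ← div_eq_mul_inv, ENNReal.div_eq_div_iff (by simp) (ENNReal.natCast_ne_top _)
    hchoose (ENNReal.natCast_ne_top _), mul_comm ((n + 1).choose (l + 1) : ℝ≥0∞)]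
  simp only [Nat.add_sub_cancel]
  exact_mod_cast (Nat.add_one_mul_choose_eq n l).trans (mul_comm _ _)

lemma sampleMean_sum (hm : 1 ≤ m) (hm' : m ≤ Fintype.card ι) (g : ι → ℝ≥0∞) :
    sampleMean m (fun A => ∑ i ∈ A, g i) = m / Fintype.card ι * ∑ i, g i := by
  classical
  have hcard (i : ι) : ((Finset.powersetCard m Finset.univ).filter fun A => i ∈ A).card =
      (Fintype.card ι - 1).choose (m - 1) := by
    simpa using Finset.card_filter_powersetCard_subset {i} Finset.univ m (by simp) (by simpa)
  calc sampleMean m (fun A => ∑ i ∈ A, g i)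
      = ((Fintype.card ι).choose m : ℝ≥0∞)⁻¹ *
          ∑ i, ∑ A ∈ Finset.powersetCard m Finset.univ, if i ∈ A then g i else 0 := by
        rw [Finset.sum_comm]
        simp only [Finset.sum_ite_mem, Finset.univ_inter, sampleMean]
    _ = ((Fintype.card ι).choose m : ℝ≥0∞)⁻¹ * (Fintype.card ι - 1).choose (m - 1) *
          ∑ i, g i := by
        simp only [← Finset.sum_filter, Finset.sum_const, hcard, nsmul_eq_mul, ← Finset.mul_sum,
          mul_assoc]
    _ = m / Fintype.card ι * ∑ i, g i := by rw [inv_choose_mul_choose hm hm']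

lemma sampleMean_exists_mem_le (hm : 1 ≤ m) (hm' : m ≤ Fintype.card ι) (p : ι → Prop)
    [DecidablePred p] :
    sampleMean m (fun A : Finset ι => if ∃ i ∈ A, p i then 1 else 0) ≤
      m / Fintype.card ι * (Finset.univ.filter p).card := by
  rw [← Finset.sum_boole, ← sampleMean_sum hm hm']
  refine sampleMean_mono fun A _ => ?_
  split_ifs with h
  · obtain ⟨i, hi, hpi⟩ := h
    calc (1 : ℝ≥0∞) = if p i then 1 else 0 := (if_pos hpi).symm
      _ ≤ ∑ i ∈ A, if p i then 1 else 0 :=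
        Finset.single_le_sum (f := fun i => if p i then (1 : ℝ≥0∞) else 0) (fun _ _ => zero_le) hi
  · exact zero_le

end Sampling

section Assignment

variable {N k m : ℕ}

/-- The mean of `F` over the assignment of a job that finds the state `q` and samples `A`. -/
noncomputable def fillMean (P : BatchFilling N k) (q : QueueState N) (A : Finset (Fin N))
    (F : (Fin k → Fin N) → ℝ≥0∞) : ℝ≥0∞ :=
  ∑ a, P.prob q A a * F a

variable (P : BatchFilling N k) (q : QueueState N)

lemma fillMean_const {A : Finset (Fin N)} (hA : A.Nonempty) (c : ℝ≥0∞) :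
    fillMean P q A (fun _ => c) = c := by
  rw [fillMean, ← Finset.sum_mul, P.sum_prob q A hA, one_mul]

lemma fillMean_add (A : Finset (Fin N)) (F G : (Fin k → Fin N) → ℝ≥0∞) :
    fillMean P q A (fun a => F a + G a) = fillMean P q A F + fillMean P q A G := by
  simp only [fillMean, mul_add, Finset.sum_add_distrib]

lemma fillMean_mono {A : Finset (Fin N)} (hA : A.Nonempty) {F G : (Fin k → Fin N) → ℝ≥0∞}
    (h : ∀ a, IsBatchFilled q A a → F a ≤ G a) : fillMean P q A F ≤ fillMean P q A G := by
  refine Finset.sum_le_sum fun a _ => ?_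
  by_cases ha : P.prob q A a = 0
  · simp [ha]
  · exact mul_le_mul_right (h a (P.isBatchFilled q A hA a ha)) _

lemma assignMean_eq_sampleMean (F : (Fin k → Fin N) → ℝ≥0∞) :
    assignMean P m q F = sampleMean m fun A => fillMean P q A F := by
  simp only [assignMean, sampleMean, fillMean, ← Finset.mul_sum, Fintype.card_fin]

lemma assignMean_add (F G : (Fin k → Fin N) → ℝ≥0∞) :
    assignMean P m q (fun a => F a + G a) = assignMean P m q F + assignMean P m q G := by
  simp only [assignMean_eq_sampleMean, fillMean_add, sampleMean_add]

lemma assignMean_mono {F G : (Fin k → Fin N) → ℝ≥0∞} (h : ∀ a, F a ≤ G a) :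
    assignMean P m q F ≤ assignMean P m q G := by
  unfold assignMean
  gcongr
  exact h _

lemma assignMean_le_sampleMean (hm : 1 ≤ m) {F : (Fin k → Fin N) → ℝ≥0∞}
    {G : Finset (Fin N) → ℝ≥0∞} (h : ∀ A a, A.card = m → IsBatchFilled q A a → F a ≤ G A) :
    assignMean P m q F ≤ sampleMean m G := by
  rw [assignMean_eq_sampleMean]
  refine sampleMean_mono fun A hA => ?_
  have hne : A.Nonempty := Finset.card_pos.1 (by omega)
  exact (fillMean_mono P q hne fun a => h A a hA).trans_eq (fillMean_const P q hne (G A))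

lemma assignMean_const (hm : 1 ≤ m) (hmN : m ≤ N) (c : ℝ≥0∞) :
    assignMean P m q (fun _ => c) = c := by
  rw [assignMean_eq_sampleMean]
  calc sampleMean m (fun A => fillMean P q A fun _ => c) = sampleMean m fun _ => c :=
        le_antisymm
          (sampleMean_mono fun A hA => (fillMean_const P q (Finset.card_pos.1 (by omega)) c).le)
          (sampleMean_mono fun A hA => (fillMean_const P q (Finset.card_pos.1 (by omega)) c).ge)
    _ = c := sampleMean_const (by simpa using hmN) c

lemma le_assignMean_add_sampleMean (hm : 1 ≤ m) (hmN : m ≤ N) {c : ℝ≥0∞}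
    {F : (Fin k → Fin N) → ℝ≥0∞} {G : Finset (Fin N) → ℝ≥0∞}
    (h : ∀ A a, IsBatchFilled q A a → c ≤ F a + G A) :
    c ≤ assignMean P m q F + sampleMean m G := by
  rw [assignMean_eq_sampleMean, ← sampleMean_add]
  refine (sampleMean_const (by simpa using hmN) c).symm.trans_le (sampleMean_mono fun A hA => ?_)
  have hne : A.Nonempty := Finset.card_pos.1 (by omega)
  calc c = fillMean P q A fun _ => c := (fillMean_const P q hne c).symm
    _ ≤ fillMean P q A fun a => F a + G A := fillMean_mono P q hne (h A)
    _ = fillMean P q A F + G A := by rw [fillMean_add, fillMean_const P q hne]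

lemma tsum_assignMean_stateAfter_mul (f : QueueState N → ℝ≥0∞) :
    ∑' q', assignMean P m q (fun a => if stateAfter q a = q' then 1 else 0) * f q' =
      assignMean P m q fun a => f (stateAfter q a) := by
  simp only [assignMean, Finset.sum_mul, Finset.mul_sum]
  rw [Summable.tsum_finsetSum fun _ _ => ENNReal.summable]
  refine Finset.sum_congr rfl fun A _ => ?_
  rw [Summable.tsum_finsetSum fun _ _ => ENNReal.summable]
  refine Finset.sum_congr rfl fun a _ => ?_
  rw [tsum_eq_single (stateAfter q a) fun q' hq' => by simp [hq'.symm]]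
  simp [mul_assoc]

end Assignment

section Dynamics

variable {N k m : ℕ} {lam : ℝ}

/-- The number of tasks of a job that the assignment `a` sends to server `i`. -/
def taskCount (a : Fin k → Fin N) (i : Fin N) : ℕ := (Finset.univ.filter fun l => a l = i).card

lemma stateAfter_apply (q : QueueState N) (a : Fin k → Fin N) (i : Fin N) :
    stateAfter q a i = q i + taskCount a i := rfl

lemma taskCount_le (a : Fin k → Fin N) (i : Fin N) : taskCount a i ≤ k := by
  simpa [taskCount] using Finset.card_filter_le (Finset.univ : Finset (Fin k)) fun l => a l = i

lemma taskCount_eq_zero {a : Fin k → Fin N} {i : Fin N} (h : ∀ j, a j ≠ i) :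
    taskCount a i = 0 :=
  Finset.card_eq_zero.2 (Finset.filter_eq_empty_iff.2 fun j _ => h j)

lemma sum_mul_taskCount {R : Type*} [CommSemiring R] (f : Fin N → R) (a : Fin k → Fin N) :
    ∑ i, f i * taskCount a i = ∑ j, f (a j) := by
  rw [← Finset.sum_fiberwise' Finset.univ a f]
  simp only [taskCount, Finset.sum_const, nsmul_eq_mul, mul_comm]

lemma sum_taskCount (a : Fin k → Fin N) : ∑ i, taskCount a i = k := by
  simpa using sum_mul_taskCount (fun _ : Fin N => (1 : ℕ)) a

/-- The state right after server `i` has completed a task. -/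
def afterDeparture (q : QueueState N) (i : Fin N) : QueueState N := Function.update q i (q i - 1)

/-- The number of busy servers. -/
def numBusy (q : QueueState N) : ℕ := (Finset.univ.filter fun i => 0 < q i).card

lemma numBusy_le (q : QueueState N) : numBusy q ≤ N := by
  simpa [numBusy] using Finset.card_filter_le (Finset.univ : Finset (Fin N)) fun i => 0 < q i

/-- The rate at which jobs arrive to `N` servers under load `lam`. -/
noncomputable def jobRate (N k : ℕ) (lam : ℝ) : ℝ≥0∞ := ENNReal.ofReal (N * lam / k)

lemma jobRate_mul (hk : 0 < k) : jobRate N k lam * k = ENNReal.ofReal (N * lam) := by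
  rw [jobRate, ← ENNReal.ofReal_natCast k, ← ENNReal.ofReal_mul' (by positivity),
    div_mul_cancel₀ _ (by positivity)]

variable (P : BatchFilling N k) (q : QueueState N)

lemma tsum_transitionRate_mul (f : QueueState N → ℝ≥0∞) :
    ∑' q', transitionRate P m lam q q' * f q' =
      jobRate N k lam * assignMean P m q (fun a => f (stateAfter q a)) +
        ∑ i with 0 < q i, f (afterDeparture q i) := by
  have hdep (i : Fin N) :
      ∑' q', (if 0 < q i ∧ Function.update q i (q i - 1) = q' then 1 else 0) * f q' =
        if 0 < q i then f (afterDeparture q i) else 0 := by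
    rw [tsum_eq_single (afterDeparture q i) fun q' hq' => by
      rw [if_neg fun h => hq' h.2.symm, zero_mul]]
    simp [afterDeparture]
  simp only [transitionRate, add_mul, mul_assoc, Finset.sum_mul]
  rw [ENNReal.tsum_add, ENNReal.tsum_mul_left, tsum_assignMean_stateAfter_mul,
    Summable.tsum_finsetSum fun _ _ => ENNReal.summable, Finset.sum_filter]
  simp only [hdep, jobRate]

lemma totalRate_transitionRate (hm : 1 ≤ m) (hmN : m ≤ N) :
    totalRate (transitionRate P m lam) q = jobRate N k lam + numBusy q := by
  simpa [totalRate, numBusy, assignMean_const P q hm hmN] using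
    tsum_transitionRate_mul (m := m) (lam := lam) P q fun _ => 1

lemma totalRate_transitionRate_le (hm : 1 ≤ m) (hmN : m ≤ N) :
    totalRate (transitionRate P m lam) q ≤ jobRate N k lam + N := by
  rw [totalRate_transitionRate P q hm hmN]
  gcongr
  exact numBusy_le q

end Dynamics

section Truncation

variable {N k m : ℕ} {lam : ℝ}

/-- The number of tasks in the system that have fewer than `M` tasks ahead of them. -/
def truncatedTasks (M : ℕ) (q : QueueState N) : ℕ := ∑ i, min (q i) M

/-- The number of tasks of a job assigned according to `a` that have fewer than `M` tasks ahead of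
them on arrival. -/
def truncatedGain (M : ℕ) (q : QueueState N) (a : Fin k → Fin N) : ℕ :=
  ∑ i, (min (q i + taskCount a i) M - min (q i) M)

/-- The number of busy servers with at most `M` tasks. -/
def numBusyAtMost (M : ℕ) (q : QueueState N) : ℕ :=
  (Finset.univ.filter fun i => 0 < q i ∧ q i ≤ M).card

/-- The number of queues shorter than `h`. -/
def numShorter (h : ℕ) (q : QueueState N) : ℕ := (Finset.univ.filter fun i => q i < h).card

lemma numBusyAtMost_le_numBusy (M : ℕ) (q : QueueState N) : numBusyAtMost M q ≤ numBusy q :=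
  Finset.card_le_card (Finset.monotone_filter_right _ fun _ _ h => h.1)

lemma numShorter_one_add_numBusy (q : QueueState N) : numShorter 1 q + numBusy q = N := by
  simpa [numShorter, numBusy, Nat.pos_iff_ne_zero] using
    Finset.card_filter_add_card_filter_not (s := Finset.univ) fun i => q i = 0

lemma numShorter_succ (h : ℕ) (q : QueueState N) :
    numShorter (h + 1) q = numShorter 1 q + numBusyAtMost h q := by
  rw [numShorter, numShorter, numBusyAtMost, ← Finset.card_union_of_disjoint]
  · congr 1
    ext i
    simp only [Finset.mem_filter_univ, Finset.mem_union]
    omega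
  · exact Finset.disjoint_filter.2 fun i _ _ => by omega

lemma sampleMean_exists_lt_le (hm : 1 ≤ m) (hmN : m ≤ N) (h : ℕ) (q : QueueState N) :
    sampleMean m (fun A : Finset (Fin N) => if ∃ i ∈ A, q i < h then 1 else 0) ≤
      m / N * numShorter h q := by
  convert sampleMean_exists_mem_le hm (by simpa using hmN) fun i => q i < h
  · exact (Fintype.card_fin N).symm
  · rfl

lemma truncatedTasks_le (M : ℕ) (q : QueueState N) : truncatedTasks M q ≤ N * M := by
  simpa [truncatedTasks] using
    Finset.sum_le_sum fun i (_ : i ∈ Finset.univ) => min_le_right (q i) M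

lemma truncatedTasks_stateAfter (M : ℕ) (q : QueueState N) (a : Fin k → Fin N) :
    truncatedTasks M (stateAfter q a) = truncatedTasks M q + truncatedGain M q a := by
  rw [truncatedTasks, truncatedTasks, truncatedGain, ← Finset.sum_add_distrib]
  exact Finset.sum_congr rfl fun i _ => by rw [stateAfter_apply]; omega

lemma truncatedGain_le (M : ℕ) (q : QueueState N) (a : Fin k → Fin N) :
    truncatedGain M q a ≤ k :=
  (Finset.sum_le_sum fun i _ => by omega).trans_eq (sum_taskCount a)

lemma truncatedGain_eq {M : ℕ} {q : QueueState N} (hM : ∑ i, q i + k ≤ M) (a : Fin k → Fin N) :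
    truncatedGain M q a = k := by
  refine (Finset.sum_congr rfl fun i _ => ?_).trans (sum_taskCount a)
  have hq : q i ≤ ∑ i, q i :=
    Finset.single_le_sum (fun _ _ => Nat.zero_le _) (Finset.mem_univ i)
  have ha := taskCount_le a i
  omega

lemma truncatedGain_eq_zero {M : ℕ} {q : QueueState N} {a : Fin k → Fin N}
    (h : ∀ j, M ≤ q (a j)) : truncatedGain M q a = 0 := by
  refine Finset.sum_eq_zero fun i _ => ?_
  by_cases hi : ∃ j, a j = i
  · obtain ⟨j, rfl⟩ := hi
    have := h j
    omega
  · rw [taskCount_eq_zero fun j hj => hi ⟨j, hj⟩, add_zero, Nat.sub_self]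

lemma truncatedTasks_afterDeparture (M : ℕ) {q : QueueState N} {i : Fin N} (hi : 0 < q i) :
    truncatedTasks M (afterDeparture q i) + (if q i ≤ M then 1 else 0) = truncatedTasks M q := by
  have hrest : ∑ j ∈ Finset.univ.erase i, min (afterDeparture q i j) M =
      ∑ j ∈ Finset.univ.erase i, min (q j) M :=
    Finset.sum_congr rfl fun j hj => by
      rw [afterDeparture, Function.update_of_ne (Finset.ne_of_mem_erase hj)]
  rw [truncatedTasks, truncatedTasks, ← Finset.add_sum_erase _ _ (Finset.mem_univ i),
    ← Finset.add_sum_erase _ (fun j => min (q j) M) (Finset.mem_univ i), hrest, afterDeparture,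
    Function.update_self]
  split_ifs <;> omega

lemma sum_truncatedTasks_afterDeparture (M : ℕ) (q : QueueState N) :
    ∑ i with 0 < q i, truncatedTasks M (afterDeparture q i) + numBusyAtMost M q =
      numBusy q * truncatedTasks M q := by
  rw [numBusyAtMost, ← Finset.filter_filter, Finset.card_filter, ← Finset.sum_add_distrib,
    Finset.sum_congr rfl fun i hi =>
      truncatedTasks_afterDeparture M (Finset.mem_filter_univ i |>.1 hi),
    Finset.sum_const, smul_eq_mul, numBusy]

/-- The rate at which tasks arrive that have fewer than `M` tasks ahead of them. -/
noncomputable def gainRate (P : BatchFilling N k) (m : ℕ) (lam : ℝ) (M : ℕ) (q : QueueState N) :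
    ℝ≥0∞ :=
  jobRate N k lam * assignMean P m q fun a => (truncatedGain M q a : ℝ≥0∞)

variable (P : BatchFilling N k)

lemma tsum_transitionRate_mul_truncatedTasks (hm : 1 ≤ m) (hmN : m ≤ N) (M : ℕ)
    (q : QueueState N) :
    ∑' q', transitionRate P m lam q q' * (truncatedTasks M q' : ℝ≥0∞) + numBusyAtMost M q =
      totalRate (transitionRate P m lam) q * truncatedTasks M q + gainRate P m lam M q := by
  have hdep : ∑ i with 0 < q i, (truncatedTasks M (afterDeparture q i) : ℝ≥0∞) +
      numBusyAtMost M q = numBusy q * truncatedTasks M q := by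
    exact_mod_cast sum_truncatedTasks_afterDeparture M q
  rw [tsum_transitionRate_mul, totalRate_transitionRate P q hm hmN, add_assoc, hdep]
  simp only [truncatedTasks_stateAfter, Nat.cast_add, gainRate]
  rw [assignMean_add, assignMean_const P q hm hmN]
  ring

lemma eventually_gainRate_eq (hm : 1 ≤ m) (hmN : m ≤ N) (hk : 0 < k) (q : QueueState N) :
    ∀ᶠ M in atTop, gainRate P m lam M q = ENNReal.ofReal (N * lam) := by
  filter_upwards [eventually_ge_atTop (∑ i, q i + k)] with M hM
  simp only [gainRate, truncatedGain_eq hM, assignMean_const P q hm hmN, jobRate_mul hk]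

/-- Only a job that samples a queue shorter than `M` puts tasks at positions below `M`. -/
lemma gainRate_le (hm : 1 ≤ m) (hmN : m ≤ N) (hk : 0 < k) (M : ℕ) (q : QueueState N) :
    gainRate P m lam M q ≤ ENNReal.ofReal (N * lam) * (m / N) * numShorter M q := by
  have hgain (A : Finset (Fin N)) (a : Fin k → Fin N) (ha : IsBatchFilled q A a) :
      (truncatedGain M q a : ℝ≥0∞) ≤ k * if ∃ i ∈ A, q i < M then 1 else 0 := by
    split_ifs with hA
    · simpa using truncatedGain_le M q a
    · push Not at hA
      simp [truncatedGain_eq_zero fun j => hA _ (ha j).1]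
  calc gainRate P m lam M q
      ≤ jobRate N k lam *
          sampleMean m fun A : Finset (Fin N) => k * if ∃ i ∈ A, q i < M then 1 else 0 :=
        mul_le_mul_right (assignMean_le_sampleMean P q hm fun A a _ => hgain A a) _
    _ ≤ jobRate N k lam * (k * (m / N * numShorter M q)) := by
        rw [sampleMean_const_mul]
        gcongr
        exact sampleMean_exists_lt_le hm hmN M q
    _ = ENNReal.ofReal (N * lam) * (m / N) * numShorter M q := by
        rw [← jobRate_mul hk]
        ring

end Truncation

section SteadyState

variable {N k m : ℕ} {P : BatchFilling N k} {lam : ℝ} {π : PMF (QueueState N)}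

/-- The tasks with fewer than `M` tasks ahead of them leave and enter the system at the same
rate. -/
lemma IsStationaryDist.pmfMean_gainRate (hπ : IsStationaryDist P m lam π) (hm : 1 ≤ m)
    (hmN : m ≤ N) (M : ℕ) :
    pmfMean π (gainRate P m lam M) = pmfMean π fun q => (numBusyAtMost M q : ℝ≥0∞) := by
  refine IsBalanced.pmfMean_gain_eq_pmfMean_loss (Q := transitionRate P m lam) hπ ?_
    (tsum_transitionRate_mul_truncatedTasks P hm hmN M)
  have hbound (q : QueueState N) : totalRate (transitionRate P m lam) q * truncatedTasks M q ≤
      (jobRate N k lam + N) * (N * M : ℕ) :=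
    mul_le_mul' (totalRate_transitionRate_le P q hm hmN) (by exact_mod_cast truncatedTasks_le M q)
  refine ne_top_of_le_ne_top ?_ ((pmfMean_mono π hbound).trans_eq (pmfMean_const π _))
  exact ENNReal.mul_ne_top (ENNReal.add_ne_top.2 ⟨ENNReal.ofReal_ne_top,
    ENNReal.natCast_ne_top N⟩) (ENNReal.natCast_ne_top _)

lemma pmfMean_numBusy_le (π : PMF (QueueState N)) :
    pmfMean π (fun q => (numBusy q : ℝ≥0∞)) ≤ N :=
  (pmfMean_mono π fun q => Nat.cast_le.2 (numBusy_le q)).trans_eq (pmfMean_const π _)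

-- Only an inequality: a stationary distribution could have infinitely many tasks in the mean, so
-- the tasks are counted up to level `M` and then `M → ∞`.
lemma IsStationaryDist.le_pmfMean_numBusy (hπ : IsStationaryDist P m lam π) (hm : 1 ≤ m)
    (hmN : m ≤ N) (hk : 0 < k) :
    ENNReal.ofReal (N * lam) ≤ pmfMean π fun q => (numBusy q : ℝ≥0∞) := by
  rw [← pmfMean_const π (ENNReal.ofReal (N * lam))]
  refine pmfMean_le_of_eventually_le
    (fun q => (eventually_gainRate_eq P hm hmN hk q).mono fun M hM => hM.ge) fun M => ?_
  rw [hπ.pmfMean_gainRate hm hmN]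
  exact pmfMean_mono π fun q => Nat.cast_le.2 (numBusyAtMost_le_numBusy M q)

/-- The mean number of queues shorter than `h` when the queues are distributed according to `π`. -/
noncomputable def meanShorter (π : PMF (QueueState N)) (h : ℕ) : ℝ≥0∞ :=
  pmfMean π fun q => (numShorter h q : ℝ≥0∞)

lemma IsStationaryDist.meanShorter_one_le (hπ : IsStationaryDist P m lam π) (hm : 1 ≤ m)
    (hmN : m ≤ N) (hk : 0 < k) :
    meanShorter π 1 ≤ ENNReal.ofReal (N * (1 - lam)) := by
  set busy := pmfMean π fun q => (numBusy q : ℝ≥0∞)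
  have hbusy : busy ≠ ∞ := ne_top_of_le_ne_top (ENNReal.natCast_ne_top N) (pmfMean_numBusy_le π)
  refine (ENNReal.add_le_add_iff_right hbusy).1 ?_
  calc meanShorter π 1 + busy = N := by
        rw [meanShorter, ← pmfMean_add]
        simp only [← Nat.cast_add, numShorter_one_add_numBusy, pmfMean_const]
    _ = ENNReal.ofReal (N * (1 - lam) + N * lam) := by
        rw [← ENNReal.ofReal_natCast]
        ring_nf
    _ ≤ ENNReal.ofReal (N * (1 - lam)) + ENNReal.ofReal (N * lam) := ENNReal.ofReal_add_le
    _ ≤ ENNReal.ofReal (N * (1 - lam)) + busy := by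
        gcongr
        exact hπ.le_pmfMean_numBusy hm hmN hk

lemma IsStationaryDist.meanShorter_succ_le (hπ : IsStationaryDist P m lam π) (hm : 1 ≤ m)
    (hmN : m ≤ N) (hk : 0 < k) (h : ℕ) :
    meanShorter π (h + 1) ≤ meanShorter π 1 + m * meanShorter π h := by
  have hN : (N : ℝ≥0∞) ≠ 0 := by exact_mod_cast (by omega : N ≠ 0)
  calc meanShorter π (h + 1)
      = meanShorter π 1 + pmfMean π (gainRate P m lam h) := by
        simp only [meanShorter, numShorter_succ h, Nat.cast_add, pmfMean_add,
          hπ.pmfMean_gainRate hm hmN]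
    _ ≤ meanShorter π 1 + ENNReal.ofReal (N * lam) * (m / N) * meanShorter π h := by
        gcongr
        exact (pmfMean_mono π (gainRate_le P hm hmN hk h)).trans_eq (pmfMean_const_mul π _ _)
    _ ≤ meanShorter π 1 + N * (m / N) * meanShorter π h := by
        gcongr
        exact (hπ.le_pmfMean_numBusy hm hmN hk).trans (pmfMean_numBusy_le π)
    _ = meanShorter π 1 + m * meanShorter π h := by
        rw [ENNReal.mul_div_cancel hN (ENNReal.natCast_ne_top N)]

lemma IsStationaryDist.add_mul_meanShorter_le (hπ : IsStationaryDist P m lam π) (hm : 1 ≤ m)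
    (hmN : m ≤ N) (hk : 0 < k) (h : ℕ) :
    ENNReal.ofReal (N * (1 - lam)) + m * meanShorter π h ≤
      (m + 1) ^ h * ENNReal.ofReal (N * (1 - lam)) := by
  set b := ENNReal.ofReal (N * (1 - lam))
  induction h with
  | zero => simp [meanShorter, numShorter, pmfMean_const]
  | succ h ih =>
    calc b + m * meanShorter π (h + 1) ≤ b + m * (b + m * meanShorter π h) := by
          gcongr
          exact (hπ.meanShorter_succ_le hm hmN hk h).trans
            (add_le_add_left (hπ.meanShorter_one_le hm hmN hk) _)
      _ ≤ b + m * (b + m * meanShorter π h) + m * meanShorter π h := le_self_add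
      _ = (m + 1) * (b + m * meanShorter π h) := by ring
      _ ≤ (m + 1) * ((m + 1) ^ h * b) := by gcongr
      _ = (m + 1) ^ (h + 1) * b := by ring

/-- A job waits behind `h` tasks unless it samples a queue shorter than `h`. -/
lemma le_jobMean_jobDelay_add_meanShorter (hm : 1 ≤ m) (hmN : m ≤ N) (hk : 0 < k) (h : ℕ) :
    (h : ℝ≥0∞) ≤ jobMean P m π jobDelay + h * (m / N * meanShorter π h) := by
  have hdelay (q : QueueState N) (A : Finset (Fin N)) (a : Fin k → Fin N)
      (ha : IsBatchFilled q A a) : (h : ℝ≥0∞) ≤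
        ∫⁻ w, ENNReal.ofReal (jobDelay q a w) ∂serviceLaw N +
          h * if ∃ i ∈ A, q i < h then 1 else 0 := by
    split_ifs with hA
    · simp
    · push Not at hA
      have hle : h ≤ lengthBefore q a ⟨0, hk⟩ (a ⟨0, hk⟩) + 1 :=
        (hA _ (ha ⟨0, hk⟩).1).trans ((Nat.le_add_right _ _).trans (Nat.le_succ _))
      calc (h : ℝ≥0∞) ≤ lengthBefore q a ⟨0, hk⟩ (a ⟨0, hk⟩) + 1 := by exact_mod_cast hle
        _ ≤ _ := (le_lintegral_jobDelay q a ⟨0, hk⟩).trans le_self_add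
  have hmean (q : QueueState N) : (h : ℝ≥0∞) ≤
      assignMean P m q (fun a => ∫⁻ w, ENNReal.ofReal (jobDelay q a w) ∂serviceLaw N) +
        h * (m / N) * numShorter h q := by
    refine (le_assignMean_add_sampleMean P q hm hmN (hdelay q)).trans ?_
    rw [sampleMean_const_mul, mul_assoc]
    gcongr
    exact sampleMean_exists_lt_le hm hmN h q
  calc (h : ℝ≥0∞) = pmfMean π fun _ => (h : ℝ≥0∞) := (pmfMean_const π _).symm
    _ ≤ _ := pmfMean_mono π hmean
    _ = jobMean P m π jobDelay + h * (m / N * meanShorter π h) := by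
        rw [pmfMean_add, pmfMean_const_mul, mul_assoc]
        rfl

lemma IsStationaryDist.le_jobMean_jobDelay_add (hπ : IsStationaryDist P m lam π) (hm : 1 ≤ m)
    (hmN : m ≤ N) (hk : 0 < k) (h : ℕ) :
    (h : ℝ≥0∞) ≤ jobMean P m π jobDelay + h * ((m + 1) ^ h * ENNReal.ofReal (1 - lam)) := by
  have hN : (N : ℝ≥0∞) ≠ 0 := by exact_mod_cast (by omega : N ≠ 0)
  refine (le_jobMean_jobDelay_add_meanShorter (P := P) (π := π) hm hmN hk h).trans ?_
  gcongr _ + _ * ?_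
  calc (m : ℝ≥0∞) / N * meanShorter π h = m * meanShorter π h / N := by
        rw [div_eq_mul_inv, div_eq_mul_inv, mul_right_comm]
    _ ≤ (m + 1) ^ h * ENNReal.ofReal (N * (1 - lam)) / N := by
        gcongr ?_ / _
        exact le_add_self.trans (hπ.add_mul_meanShorter_le hm hmN hk h)
    _ = (m + 1) ^ h * ENNReal.ofReal (1 - lam) := by
        rw [ENNReal.ofReal_mul (Nat.cast_nonneg N), ENNReal.ofReal_natCast, mul_left_comm,
          mul_comm, ENNReal.mul_div_cancel_right hN (ENNReal.natCast_ne_top N)]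

lemma jobMean_inherentDelay_le (hm : 1 ≤ m) (hmN : m ≤ N) (hk : 0 < k) :
    jobMean P m π inherentDelay ≤ ENNReal.ofReal (Real.log k + 1) := by
  rw [← pmfMean_const π (ENNReal.ofReal (Real.log k + 1))]
  refine pmfMean_mono π fun q => ?_
  exact (assignMean_mono P q fun a => lintegral_inherentDelay_le q a hk).trans_eq
    (assignMean_const P q hm hmN _)

lemma jobMean_jobDelay_le :
    jobMean P m π jobDelay ≤
      jobMean P m π (fun q a w => jobDelay q a w - inherentDelay q a w) +
        jobMean P m π inherentDelay := by
  unfold jobMean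
  rw [← ENNReal.tsum_add]
  refine ENNReal.tsum_le_tsum fun q => ?_
  rw [← mul_add, ← assignMean_add]
  exact mul_le_mul_right (assignMean_mono P q fun a => lintegral_jobDelay_le q a) _

end SteadyState

section Existence

variable {N k m : ℕ} {lam : ℝ}

/-- The sum of the squared queue lengths, the Lyapunov function of the chain. -/
def sumSq (q : QueueState N) : ℕ := ∑ i, q i ^ 2

lemma sumSq_stateAfter (q : QueueState N) (a : Fin k → Fin N) :
    sumSq (stateAfter q a) = sumSq q + 2 * ∑ j, q (a j) + ∑ i, taskCount a i ^ 2 := by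
  have hcross : ∑ j, q (a j) = ∑ i, q i * taskCount a i := by
    simpa using (sum_mul_taskCount q a).symm
  simp only [sumSq, stateAfter_apply, hcross, Finset.mul_sum, ← Finset.sum_add_distrib]
  exact Finset.sum_congr rfl fun i _ => by ring

lemma sum_taskCount_sq_le (a : Fin k → Fin N) : ∑ i, taskCount a i ^ 2 ≤ k ^ 2 :=
  calc ∑ i, taskCount a i ^ 2 ≤ ∑ i, k * taskCount a i :=
        Finset.sum_le_sum fun i _ => by rw [sq]; exact Nat.mul_le_mul_right _ (taskCount_le a i)
    _ = k ^ 2 := by rw [← Finset.mul_sum, sum_taskCount, sq]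

lemma IsBatchFilled.card_mul_le {q : QueueState N} {A : Finset (Fin N)} {a : Fin k → Fin N}
    (ha : IsBatchFilled q A a) (j : Fin k) :
    A.card * q (a j) ≤ ∑ i ∈ A, q i + A.card * k := by
  rw [← smul_eq_mul, ← smul_eq_mul, ← Finset.sum_const, ← Finset.sum_const,
    ← Finset.sum_add_distrib]
  refine Finset.sum_le_sum fun i hi => ?_
  have hbefore : lengthBefore q a j i ≤ q i + k := Nat.add_le_add_left (by
    simpa using Finset.card_filter_le (Finset.univ : Finset (Fin k)) fun l => l < j ∧ a l = i) _
  exact (Nat.le_add_right _ _).trans (((ha j).2 i hi).trans hbefore)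

lemma IsBatchFilled.card_mul_sumSq_stateAfter_le {q : QueueState N} {A : Finset (Fin N)}
    {a : Fin k → Fin N} (ha : IsBatchFilled q A a) :
    A.card * sumSq (stateAfter q a) ≤
      A.card * (sumSq q + 3 * k ^ 2) + 2 * k * ∑ i ∈ A, q i := by
  have hjoin : A.card * ∑ j, q (a j) ≤ k * (∑ i ∈ A, q i + A.card * k) := by
    rw [Finset.mul_sum]
    exact (Finset.sum_le_sum fun j _ => ha.card_mul_le j).trans_eq (by simp)
  calc A.card * sumSq (stateAfter q a)
      = A.card * sumSq q + 2 * (A.card * ∑ j, q (a j)) + A.card * ∑ i, taskCount a i ^ 2 := by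
        rw [sumSq_stateAfter]
        ring
    _ ≤ A.card * sumSq q + 2 * (k * (∑ i ∈ A, q i + A.card * k)) + A.card * k ^ 2 := by
        gcongr
        exact sum_taskCount_sq_le a
    _ = A.card * (sumSq q + 3 * k ^ 2) + 2 * k * ∑ i ∈ A, q i := by ring

variable (P : BatchFilling N k) (q : QueueState N)

lemma assignMean_sumSq_stateAfter_le (hm : 1 ≤ m) (hmN : m ≤ N) :
    assignMean P m q (fun a => (sumSq (stateAfter q a) : ℝ≥0∞)) ≤
      sumSq q + 3 * k ^ 2 + 2 * k / N * (∑ i, q i : ℕ) := by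
  have hm0 : (m : ℝ≥0∞) ≠ 0 := by exact_mod_cast (by omega : m ≠ 0)
  have hmt : (m : ℝ≥0∞) ≠ ∞ := ENNReal.natCast_ne_top m
  have hfill (A : Finset (Fin N)) (a : Fin k → Fin N) (hA : A.card = m)
      (ha : IsBatchFilled q A a) : (sumSq (stateAfter q a) : ℝ≥0∞) ≤
        (sumSq q + 3 * k ^ 2) + 2 * k / m * ∑ i ∈ A, (q i : ℝ≥0∞) := by
    rw [← ENNReal.mul_le_mul_iff_right hm0 hmt, mul_add, ← mul_assoc (m : ℝ≥0∞) (2 * k / m),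
      ENNReal.mul_div_cancel hm0 hmt]
    exact_mod_cast hA ▸ ha.card_mul_sumSq_stateAfter_le
  calc assignMean P m q (fun a => (sumSq (stateAfter q a) : ℝ≥0∞))
      ≤ sampleMean m fun A => (sumSq q + 3 * k ^ 2) + 2 * k / m * ∑ i ∈ A, (q i : ℝ≥0∞) :=
        assignMean_le_sampleMean P q hm hfill
    _ = sumSq q + 3 * k ^ 2 + 2 * k / m * (m / N * (∑ i, q i : ℕ)) := by
        rw [sampleMean_add, sampleMean_const (by simpa using hmN), sampleMean_const_mul,
          sampleMean_sum hm (by simpa using hmN), Fintype.card_fin, Nat.cast_sum]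
    _ = sumSq q + 3 * k ^ 2 + 2 * k / N * (∑ i, q i : ℕ) := by
        rw [← mul_assoc, ← mul_div_assoc, ENNReal.div_mul_cancel hm0 hmt]

variable {q} in
lemma sumSq_afterDeparture_add_le {i : Fin N} (hi : 0 < q i) :
    sumSq (afterDeparture q i) + 2 * q i ≤ sumSq q + 1 := by
  have hrest : ∑ j ∈ Finset.univ.erase i, afterDeparture q i j ^ 2 =
      ∑ j ∈ Finset.univ.erase i, q j ^ 2 :=
    Finset.sum_congr rfl fun j hj => by
      rw [afterDeparture, Function.update_of_ne (Finset.ne_of_mem_erase hj)]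
  rw [sumSq, sumSq, ← Finset.add_sum_erase _ _ (Finset.mem_univ i),
    ← Finset.add_sum_erase _ (fun j => q j ^ 2) (Finset.mem_univ i), hrest, afterDeparture,
    Function.update_self]
  obtain ⟨n, hn⟩ := Nat.exists_eq_add_of_le' hi
  rw [hn, Nat.add_sub_cancel]
  linarith

lemma sum_sumSq_afterDeparture_add_le :
    ∑ i with 0 < q i, sumSq (afterDeparture q i) + 2 * ∑ i, q i ≤ numBusy q * sumSq q + N := by
  have hbusy : ∑ i, q i = ∑ i with 0 < q i, q i :=
    (Finset.sum_filter_of_ne fun i _ hi => Nat.pos_of_ne_zero hi).symm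
  calc ∑ i with 0 < q i, sumSq (afterDeparture q i) + 2 * ∑ i, q i
      = ∑ i with 0 < q i, (sumSq (afterDeparture q i) + 2 * q i) := by
        rw [hbusy, Finset.mul_sum, Finset.sum_add_distrib]
    _ ≤ ∑ i with 0 < q i, (sumSq q + 1) := Finset.sum_le_sum fun i hi =>
        sumSq_afterDeparture_add_le ((Finset.mem_filter_univ i).1 hi)
    _ = numBusy q * sumSq q + numBusy q := by
        rw [Finset.sum_const, smul_eq_mul, mul_add, mul_one, numBusy]
    _ ≤ numBusy q * sumSq q + N := Nat.add_le_add_left (numBusy_le q) _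

/-- Tasks arrive at total rate `N * lam` and are spread evenly up to a constant, whereas departures
act on all queues at rate `1`; hence the factor `1 - lam` in the drift. -/
lemma tsum_transitionRate_mul_sumSq_add_le (hm : 1 ≤ m) (hmN : m ≤ N) (hk : 0 < k)
    (hlam : 0 ≤ lam) (hlam1 : lam ≤ 1) :
    ∑' q', transitionRate P m lam q q' * (sumSq q' : ℝ≥0∞) +
        2 * ENNReal.ofReal (1 - lam) * (∑ i, q i : ℕ) ≤
      totalRate (transitionRate P m lam) q * sumSq q + (jobRate N k lam * (3 * k ^ 2) + N) := by
  have hN : (N : ℝ≥0∞) ≠ 0 := by exact_mod_cast (by omega : N ≠ 0)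
  have hdeparture : ∑ i with 0 < q i, (sumSq (afterDeparture q i) : ℝ≥0∞) +
      2 * (∑ i, q i : ℕ) ≤ numBusy q * sumSq q + N := by
    exact_mod_cast sum_sumSq_afterDeparture_add_le q
  set s : ℝ≥0∞ := ((∑ i, q i : ℕ) : ℝ≥0∞)
  set departures : ℝ≥0∞ := ∑ i with 0 < q i, (sumSq (afterDeparture q i) : ℝ≥0∞)
  have harrival : jobRate N k lam * (2 * k / N) = 2 * ENNReal.ofReal lam := by
    rw [← mul_div_assoc, mul_left_comm, jobRate_mul hk, ENNReal.ofReal_mul N.cast_nonneg,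
      ENNReal.ofReal_natCast, mul_comm (N : ℝ≥0∞), ← mul_assoc,
      ENNReal.mul_div_cancel_right hN (ENNReal.natCast_ne_top N)]
  have hload : ENNReal.ofReal lam + ENNReal.ofReal (1 - lam) = 1 := by
    rw [← ENNReal.ofReal_add hlam (by linarith), add_sub_cancel, ENNReal.ofReal_one]
  rw [tsum_transitionRate_mul, totalRate_transitionRate P q hm hmN]
  calc jobRate N k lam * assignMean P m q (fun a => (sumSq (stateAfter q a) : ℝ≥0∞)) +
        departures + 2 * ENNReal.ofReal (1 - lam) * s
      ≤ jobRate N k lam * (sumSq q + 3 * k ^ 2 + 2 * k / N * s) + departures +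
          2 * ENNReal.ofReal (1 - lam) * s := by
        gcongr
        exact assignMean_sumSq_stateAfter_le P q hm hmN
    _ = jobRate N k lam * (sumSq q + 3 * k ^ 2) + departures +
          (jobRate N k lam * (2 * k / N) + 2 * ENNReal.ofReal (1 - lam)) * s := by ring
    _ = jobRate N k lam * (sumSq q + 3 * k ^ 2) + (departures + 2 * s) := by
        rw [harrival, ← mul_add, hload, mul_one, add_assoc]
    _ ≤ jobRate N k lam * (sumSq q + 3 * k ^ 2) + (numBusy q * sumSq q + N) := by gcongr
    _ = (jobRate N k lam + numBusy q) * sumSq q + (jobRate N k lam * (3 * k ^ 2) + N) := by ring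

lemma finite_setOf_sum_le (n : ℕ) : {q : QueueState N | ∑ i, q i ≤ n}.Finite :=
  (Set.finite_Iic (fun _ => n : Fin N → ℕ)).subset fun _ hq i =>
    (Finset.single_le_sum (fun _ _ => Nat.zero_le _) (Finset.mem_univ i)).trans hq

lemma finite_setOf_mul_sum_le {c b : ℝ≥0∞} (hc : c ≠ 0) (hb : b ≠ ∞) :
    {q : QueueState N | c * (∑ i, q i : ℕ) ≤ b}.Finite := by
  obtain ⟨n, hn⟩ := ENNReal.exists_nat_mul_gt hc hb
  refine (finite_setOf_sum_le n).subset fun q hq => ?_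
  by_contra hlt
  have hle : (n : ℝ≥0∞) ≤ (∑ i, q i : ℕ) := Nat.cast_le.2 (not_le.1 hlt).le
  exact (hn.trans_le ((mul_le_mul_left hle c).trans_eq (mul_comm _ _))).not_ge hq

theorem exists_isStationaryDist (hm : 1 ≤ m) (hmN : m ≤ N) (hk : 0 < k) (hlam : 0 ≤ lam)
    (hlam1 : lam < 1) : ∃ π, IsStationaryDist P m lam π := by
  have hN : (N : ℝ≥0∞) ≠ 0 := by exact_mod_cast (by omega : N ≠ 0)
  have hrate : jobRate N k lam ≠ ∞ := ENNReal.ofReal_ne_top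
  have hslack : 2 * ENNReal.ofReal (1 - lam) ≠ 0 :=
    mul_ne_zero two_ne_zero (ENNReal.ofReal_pos.2 (by linarith)).ne'
  exact exists_isBalanced (Λ := jobRate N k lam + N) (by simp [hN]) (by simp [hrate])
    (totalRate_transitionRate_le P · hm hmN)
    (ENNReal.add_ne_top.2 ⟨ENNReal.mul_ne_top hrate (by finiteness), ENNReal.natCast_ne_top N⟩)
    (tsum_transitionRate_mul_sumSq_add_le P · hm hmN hk hlam hlam1.le)
    (fun b hb => finite_setOf_mul_sum_le hslack hb) (x₀ := 0) (ENNReal.natCast_ne_top _)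

end Existence

section Asymptotics

variable {α : ℝ} {k : ℕ → ℕ} {lam : ℕ → ℝ}

lemma IsExpLittleO.isLittleO_log {f g : ℕ → ℝ} (h : IsExpLittleO f g) :
    (fun N => Real.log (f N)) =o[atTop] g := by
  obtain ⟨e, he, hfe⟩ := h
  exact he.congr' (hfe.mono fun N hN => by simp only [hN, Real.log_exp]) EventuallyEq.rfl

lemma IsExpLittleO.eventually_pos_and_le {f g : ℕ → ℝ} (h : IsExpLittleO f g)
    (hg : ∀ᶠ N in atTop, 0 ≤ g N) {c : ℝ} (hc : 0 < c) :
    ∀ᶠ N in atTop, 0 < f N ∧ f N ≤ Real.exp (c * g N) := by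
  obtain ⟨e, he, hfe⟩ := h
  filter_upwards [he.bound hc, hfe, hg] with N hbound hN hgN
  rw [Real.norm_of_nonneg hgN] at hbound
  rw [hN]
  exact ⟨Real.exp_pos _, Real.exp_le_exp.2 ((Real.le_norm_self _).trans hbound)⟩

lemma isLittleO_log_sq (hk : IsExpLittleO (fun N => (k N : ℝ)) fun N => √(Real.log N)) :
    (fun N => Real.log (k N) ^ 2) =o[atTop] fun N : ℕ => Real.log N :=
  (hk.isLittleO_log.pow two_pos).congr_right fun N => Real.sq_sqrt (Real.log_natCast_nonneg N)

lemma mul_exp_add_one_pow_ceil_le {K y : ℝ} (hK : 1 ≤ K) (hy : 0 ≤ y) :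
    (Real.exp K * Real.exp y + 1) ^ ⌈3 * K⌉₊ ≤ Real.exp (8 * K ^ 2 + 4 * K * y) := by
  have hbase : Real.exp K * Real.exp y + 1 ≤ Real.exp (2 * K + y) := by
    have htwo : 2 ≤ Real.exp K := by linarith [Real.add_one_le_exp K]
    have hone : 1 ≤ Real.exp K * Real.exp y :=
      one_le_mul_of_one_le_of_one_le (by linarith) (Real.one_le_exp hy)
    calc Real.exp K * Real.exp y + 1 ≤ 2 * (Real.exp K * Real.exp y) := by linarith
      _ ≤ Real.exp K * (Real.exp K * Real.exp y) := by gcongr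
      _ = Real.exp (2 * K + y) := by
        rw [← Real.exp_add, ← Real.exp_add]
        ring_nf
  have hceil : (⌈3 * K⌉₊ : ℝ) ≤ 4 * K := by
    linarith [Nat.ceil_lt_add_one (a := 3 * K) (by linarith)]
  calc (Real.exp K * Real.exp y + 1) ^ ⌈3 * K⌉₊ ≤ Real.exp (2 * K + y) ^ ⌈3 * K⌉₊ := by gcongr
    _ = Real.exp (⌈3 * K⌉₊ * (2 * K + y)) := (Real.exp_nat_mul _ _).symm
    _ ≤ Real.exp (4 * K * (2 * K + y)) := by gcongr
    _ = Real.exp (8 * K ^ 2 + 4 * K * y) := by ring_nf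

lemma tendsto_log_natCast (hk' : Tendsto k atTop atTop) :
    Tendsto (fun N => Real.log (k N)) atTop atTop :=
  Real.tendsto_log_atTop.comp (tendsto_natCast_atTop_atTop.comp hk')

lemma eventually_exp_log_eq (hk' : Tendsto k atTop atTop) :
    ∀ᶠ N in atTop, Real.exp (Real.log (k N)) = k N :=
  (hk'.eventually_gt_atTop 0).mono fun _ hN => Real.exp_log (Nat.cast_pos.2 hN)

lemma isBigO_mul_exp_add_one_pow (hα : 0 < α) (hk' : Tendsto k atTop atTop)
    (hsq : (fun N => Real.log (k N) ^ 2) =o[atTop] fun N : ℕ => Real.log N) :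
    (fun N : ℕ => (k N * Real.exp (α / 16 * (Real.log N / Real.log (k N))) + 1) ^
      ⌈3 * Real.log (k N)⌉₊) =O[atTop] fun N : ℕ => (N : ℝ) ^ (α / 2) := by
  refine IsBigO.of_bound' ?_
  filter_upwards [(tendsto_log_natCast hk').eventually_ge_atTop 1, eventually_exp_log_eq hk',
    hsq.bound (show 0 < α / 32 by positivity), eventually_gt_atTop 0] with N hK hexp hK2 hN
  have hL : 0 ≤ Real.log N := Real.log_natCast_nonneg N
  rw [Real.norm_of_nonneg (sq_nonneg _), Real.norm_of_nonneg hL] at hK2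
  rw [Real.norm_of_nonneg (by positivity), Real.norm_of_nonneg (by positivity)]
  have hy : 0 ≤ α / 16 * (Real.log N / Real.log (k N)) := by positivity
  have hcancel : 4 * Real.log (k N) * (α / 16 * (Real.log N / Real.log (k N))) =
      α / 4 * Real.log N := by
    field_simp
    norm_num
  calc (k N * Real.exp (α / 16 * (Real.log N / Real.log (k N))) + 1) ^ ⌈3 * Real.log (k N)⌉₊
      ≤ Real.exp (8 * Real.log (k N) ^ 2 + α / 4 * Real.log N) := by
        simpa only [hexp, hcancel] using mul_exp_add_one_pow_ceil_le hK hy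
    _ ≤ Real.exp (Real.log N * (α / 2)) := Real.exp_le_exp.2 (by linarith)
    _ = (N : ℝ) ^ (α / 2) := (Real.rpow_def_of_pos (Nat.cast_pos.2 hN) _).symm

lemma tendsto_natCast_rpow_neg {γ : ℝ} (hγ : 0 < γ) :
    Tendsto (fun N : ℕ => (N : ℝ) ^ (-γ)) atTop (𝓝 0) :=
  (tendsto_rpow_neg_atTop hγ).comp tendsto_natCast_atTop_atTop

lemma tendsto_one_sub_mul_pow (hα : 0 < α)
    (hlam : (fun N => 1 - lam N) =O[atTop] fun N : ℕ => (N : ℝ) ^ (-α))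
    (hk' : Tendsto k atTop atTop)
    (hsq : (fun N => Real.log (k N) ^ 2) =o[atTop] fun N : ℕ => Real.log N) :
    Tendsto (fun N : ℕ => (1 - lam N) *
      (k N * Real.exp (α / 16 * (Real.log N / Real.log (k N))) + 1) ^ ⌈3 * Real.log (k N)⌉₊)
      atTop (𝓝 0) := by
  refine IsBigO.trans_tendsto ?_ (tendsto_natCast_rpow_neg (half_pos hα))
  refine (hlam.mul (isBigO_mul_exp_add_one_pow hα hk' hsq)).congr' EventuallyEq.rfl ?_
  filter_upwards [eventually_gt_atTop 0] with N hN
  rw [← Real.rpow_add (Nat.cast_pos.2 hN)]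
  ring_nf

lemma eventually_mul_exp_le (hk' : Tendsto k atTop atTop)
    (hsq : (fun N => Real.log (k N) ^ 2) =o[atTop] fun N : ℕ => Real.log N) (c : ℝ) :
    ∀ᶠ N : ℕ in atTop, k N * Real.exp (c * (Real.log N / Real.log (k N))) ≤ N := by
  filter_upwards [(tendsto_log_natCast hk').eventually_ge_atTop 1,
    (tendsto_log_natCast hk').eventually_ge_atTop (2 * c), eventually_exp_log_eq hk',
    hsq.bound one_half_pos, eventually_gt_atTop 0] with N hK hKc hexp hK2 hN
  have hL : 0 ≤ Real.log N := Real.log_natCast_nonneg N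
  rw [Real.norm_of_nonneg (sq_nonneg _), Real.norm_of_nonneg hL] at hK2
  have hlog : Real.log (k N) ≤ 1 / 2 * Real.log N := (le_self_pow₀ hK two_ne_zero).trans hK2
  have hprobe : c * (Real.log N / Real.log (k N)) ≤ 1 / 2 * Real.log N := by
    rw [mul_div_assoc', div_le_iff₀ (by linarith)]
    nlinarith
  calc k N * Real.exp (c * (Real.log N / Real.log (k N)))
      = Real.exp (Real.log (k N) + c * (Real.log N / Real.log (k N))) := by
        rw [Real.exp_add, hexp]
    _ ≤ Real.exp (Real.log N) := Real.exp_le_exp.2 (by linarith)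
    _ = N := Real.exp_log (Nat.cast_pos.2 hN)

lemma IsStationaryDist.two_log_le_jobMean_jobDelay {N k m : ℕ} {P : BatchFilling N k} {lam : ℝ}
    {π : PMF (QueueState N)} (hπ : IsStationaryDist P m lam π) (hm : 1 ≤ m) (hmN : m ≤ N)
    (hk : 0 < k) (h : (1 - lam) * ((m : ℝ) + 1) ^ ⌈3 * Real.log k⌉₊ ≤ 1 / 3) :
    ENNReal.ofReal (2 * Real.log k) ≤ jobMean P m π jobDelay := by
  set n := ⌈3 * Real.log k⌉₊
  have hn : 3 * Real.log k ≤ n := Nat.le_ceil _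
  have hshort : (m + 1 : ℝ≥0∞) ^ n * ENNReal.ofReal (1 - lam) ≤ ENNReal.ofReal (1 / 3) := by
    have hcast : (m + 1 : ℝ≥0∞) ^ n = ENNReal.ofReal (((m : ℝ) + 1) ^ n) := by
      rw [ENNReal.ofReal_pow (by positivity), ENNReal.ofReal_add m.cast_nonneg zero_le_one,
        ENNReal.ofReal_natCast, ENNReal.ofReal_one]
    rw [hcast, ← ENNReal.ofReal_mul (by positivity), mul_comm]
    exact ENNReal.ofReal_le_ofReal h
  refine (ENNReal.add_le_add_iff_right (a := ENNReal.ofReal (n * (1 / 3)))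
    ENNReal.ofReal_ne_top).1 ?_
  calc ENNReal.ofReal (2 * Real.log k) + ENNReal.ofReal (n * (1 / 3))
      = ENNReal.ofReal (2 * Real.log k + n * (1 / 3)) :=
        (ENNReal.ofReal_add (by positivity) (by positivity)).symm
    _ ≤ ENNReal.ofReal n := ENNReal.ofReal_le_ofReal (by linarith)
    _ = n := ENNReal.ofReal_natCast n
    _ ≤ jobMean P m π jobDelay + n * ((m + 1) ^ n * ENNReal.ofReal (1 - lam)) :=
        hπ.le_jobMean_jobDelay_add hm hmN hk n
    _ ≤ jobMean P m π jobDelay + n * ENNReal.ofReal (1 / 3) := by gcongr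
    _ = jobMean P m π jobDelay + ENNReal.ofReal (n * (1 / 3)) := by
        rw [ENNReal.ofReal_mul n.cast_nonneg, ENNReal.ofReal_natCast]

lemma eventually_two_log_le_jobMean_jobDelay (hα : 0 < α) (hlam1 : ∀ᶠ N in atTop, lam N ≤ 1)
    (hlam : (fun N => 1 - lam N) =O[atTop] fun N : ℕ => (N : ℝ) ^ (-α))
    (hk' : Tendsto k atTop atTop)
    (hsq : (fun N => Real.log (k N) ^ 2) =o[atTop] fun N : ℕ => Real.log N) :
    ∀ᶠ N : ℕ in atTop, ∀ (P : BatchFilling N (k N)) (m : ℕ) (π : PMF (QueueState N)),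
      1 ≤ m → m ≤ N → (m : ℝ) ≤ k N * Real.exp (α / 16 * (Real.log N / Real.log (k N))) →
      IsStationaryDist P m (lam N) π →
      ENNReal.ofReal (2 * Real.log (k N)) ≤ jobMean P m π jobDelay := by
  filter_upwards [hlam1, hk'.eventually_gt_atTop 0,
    (tendsto_one_sub_mul_pow hα hlam hk' hsq).eventually_le_const
      (show (0 : ℝ) < 1 / 3 by norm_num)]
    with N hload hkN hsmall P m π hm hmN hmk hπ
  refine hπ.two_log_le_jobMean_jobDelay hm hmN hkN (le_trans ?_ hsmall)
  gcongr

lemma eventually_exists_isStationaryDist (hα : 0 < α) (hlam1 : ∀ᶠ N in atTop, lam N < 1)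
    (hlam : (fun N => 1 - lam N) =O[atTop] fun N : ℕ => (N : ℝ) ^ (-α))
    (hk' : Tendsto k atTop atTop) :
    ∀ᶠ N : ℕ in atTop, ∀ (P : BatchFilling N (k N)) (m : ℕ), 1 ≤ m → m ≤ N →
      ∃ π, IsStationaryDist P m (lam N) π := by
  have hslack := hlam.trans_tendsto (tendsto_natCast_rpow_neg hα)
  filter_upwards [hlam1, hslack.eventually_le_const one_pos, hk'.eventually_gt_atTop 0]
    with N hlt hle hkN P m hm hmN
  exact exists_isStationaryDist P hm hmN hkN (by linarith) hlt

lemma jobMean_jobDelay_le_of_jobMean_sub_le {N k m : ℕ} {P : BatchFilling N k}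
    {π : PMF (QueueState N)} (hm : 1 ≤ m) (hmN : m ≤ N) (hk : 0 < k) {ε : ℝ} (hε : 0 ≤ ε)
    (h : jobMean P m π (fun q a w => jobDelay q a w - inherentDelay q a w) ≤
      ENNReal.ofReal ε * jobMean P m π inherentDelay) :
    jobMean P m π jobDelay ≤ ENNReal.ofReal ((ε + 1) * (Real.log k + 1)) := by
  calc jobMean P m π jobDelay
      ≤ jobMean P m π (fun q a w => jobDelay q a w - inherentDelay q a w) +
          jobMean P m π inherentDelay := jobMean_jobDelay_le
    _ ≤ ENNReal.ofReal ε * jobMean P m π inherentDelay + jobMean P m π inherentDelay := by gcongr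
    _ = ENNReal.ofReal (ε + 1) * jobMean P m π inherentDelay := by
        rw [ENNReal.ofReal_add hε zero_le_one, ENNReal.ofReal_one, add_mul, one_mul]
    _ ≤ ENNReal.ofReal (ε + 1) * ENNReal.ofReal (Real.log k + 1) := by
        gcongr
        exact jobMean_inherentDelay_le hm hmN hk
    _ = ENNReal.ofReal ((ε + 1) * (Real.log k + 1)) :=
        (ENNReal.ofReal_mul (by positivity)).symm

lemma ZeroQueueingDelay.eventually_jobMean_jobDelay_le {m : ℕ → ℕ} {P : ∀ N, BatchFilling N (k N)}
    {π : ∀ N, PMF (QueueState N)} (h : ZeroQueueingDelay k m P π) (hk' : Tendsto k atTop atTop)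
    (hm : ∀ᶠ N : ℕ in atTop, 1 ≤ m N ∧ m N ≤ N) {ε : ℝ} (hε : 0 < ε) :
    ∀ᶠ N in atTop, jobMean (P N) (m N) (π N) jobDelay ≤
      ENNReal.ofReal ((ε + 1) * (Real.log (k N) + 1)) := by
  filter_upwards [h.eventually_le_const (ENNReal.ofReal_pos.2 hε), hk'.eventually_gt_atTop 0, hm]
    with N hratio hkN ⟨hm, hmN⟩
  exact jobMean_jobDelay_le_of_jobMean_sub_le hm hmN hkN hε.le
    ((ENNReal.div_le_iff_le_mul (Or.inr ENNReal.ofReal_ne_top)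
      (Or.inr (ENNReal.ofReal_pos.2 hε).ne')).1 hratio)

lemma load_lt_one {β : ℝ} (hβ : 0 < β) {N : ℕ} (hN : 0 < N) : load α β N < 1 :=
  sub_lt_self 1 (by positivity)

lemma isBigO_one_sub_load (α β : ℝ) :
    (fun N => 1 - load α β N) =O[atTop] fun N : ℕ => (N : ℝ) ^ (-α) := by
  simpa only [load, sub_sub_cancel] using isBigO_const_mul_self β _ _

end Asymptotics

theorem theorem4_general {α : ℝ} (hα : 0 < α) {lam : ℕ → ℝ} (hlam1 : ∀ᶠ N in atTop, lam N < 1)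
    (hlam : (fun N => 1 - lam N) =O[atTop] fun N : ℕ => (N : ℝ) ^ (-α)) {k : ℕ → ℕ}
    (hk : IsExpLittleO (fun N => (k N : ℝ)) (fun N => √(Real.log N)))
    (hk' : Tendsto k atTop atTop) (P : ∀ N, BatchFilling N (k N)) {d : ℕ → ℝ} {m : ℕ → ℕ}
    (hm : ∀ᶠ N : ℕ in atTop, (m N : ℝ) = k N * d N) :
    (IsExpLittleO d (fun N => Real.log N / Real.log (k N)) →
      ∀ᶠ N : ℕ in atTop,
        (∃ π, IsStationaryDist (P N) (m N) (lam N) π) ∧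
        ∀ π, IsStationaryDist (P N) (m N) (lam N) π →
          ENNReal.ofReal (2 * Real.log (k N)) ≤ jobMean (P N) (m N) π jobDelay) ∧
    ((∀ᶠ N : ℕ in atTop, 1 ≤ m N ∧ m N ≤ N) →
      ∀ π : ∀ N, PMF (QueueState N),
        (∀ᶠ N : ℕ in atTop, IsStationaryDist (P N) (m N) (lam N) (π N)) →
        ZeroQueueingDelay k m P π →
        ∃ c : ℝ, 0 < c ∧
          ∀ᶠ N : ℕ in atTop, Real.exp (c * (Real.log N / Real.log (k N))) ≤ d N) := by
  have hsq := isLittleO_log_sq hk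
  have hdelay :=
    eventually_two_log_le_jobMean_jobDelay hα (hlam1.mono fun _ => le_of_lt) hlam hk' hsq
  have hprobe : ∀ᶠ N : ℕ in atTop, d N ≤ Real.exp (α / 16 * (Real.log N / Real.log (k N))) →
      (m N : ℝ) ≤ k N * Real.exp (α / 16 * (Real.log N / Real.log (k N))) :=
    hm.mono fun N hmd hd => hmd ▸ mul_le_mul_of_nonneg_left hd (k N).cast_nonneg
  refine ⟨fun hd => ?_, fun hmN π hπ hzero => ⟨α / 16, by positivity, ?_⟩⟩
  · have hd' := hd.eventually_pos_and_le (.of_forall fun N => div_nonneg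
      (Real.log_natCast_nonneg N) (Real.log_natCast_nonneg (k N))) (show 0 < α / 16 by positivity)
    filter_upwards [eventually_exists_isStationaryDist hα hlam1 hlam hk', hdelay, hprobe, hm, hd',
      hk'.eventually_gt_atTop 0, eventually_mul_exp_le hk' hsq (α / 16)]
      with N hexists hdelay hprobe hm ⟨hd0, hd⟩ hkN hle
    have hm1 : 1 ≤ m N := Nat.cast_pos.1 (hm ▸ mul_pos (Nat.cast_pos.2 hkN) hd0)
    have hmN : m N ≤ N := Nat.cast_le.1 ((hprobe hd).trans hle)
    exact ⟨hexists (P N) (m N) hm1 hmN, fun π => hdelay (P N) (m N) π hm1 hmN (hprobe hd)⟩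
  · filter_upwards [(tendsto_log_natCast hk').eventually_ge_atTop 2, hdelay, hprobe, hmN, hπ,
      hzero.eventually_jobMean_jobDelay_le hk' hmN (show (0 : ℝ) < 1 / 4 by norm_num)]
      with N hK hdelay hprobe ⟨hm1, hmN⟩ hπ hzero
    by_contra! hd
    have hlow := hdelay (P N) (m N) (π N) hm1 hmN (hprobe hd.le) hπ
    have hbounds := (ENNReal.ofReal_le_ofReal_iff (by linarith)).1 (hlow.trans hzero)
    linarith

theorem theorem4 (α β : ℝ) (hα : 0 < α) (hα' : α < 1 / 2) (hβ : 0 < β) (hβ' : β ≤ 1)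
    (k : ℕ → ℕ)
    (hk : IsExpLittleO (fun N => (k N : ℝ)) (fun N => √(Real.log N)))
    (hk' : Tendsto k atTop atTop)
    (P : ∀ N, BatchFilling N (k N))
    (d : ℕ → ℝ) (m : ℕ → ℕ) (hm : ∀ᶠ N : ℕ in atTop, (m N : ℝ) = k N * d N) :
    (IsExpLittleO d (fun N => Real.log N / Real.log (k N)) →
      ∀ᶠ N : ℕ in atTop,
        (∃ π, IsStationaryDist (P N) (m N) (load α β N) π) ∧
        ∀ π, IsStationaryDist (P N) (m N) (load α β N) π →
          ENNReal.ofReal (2 * Real.log (k N)) ≤ jobMean (P N) (m N) π jobDelay) ∧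
    ((∀ᶠ N : ℕ in atTop, 1 ≤ m N ∧ m N ≤ N) →
      ∀ π : ∀ N, PMF (QueueState N),
        (∀ᶠ N : ℕ in atTop, IsStationaryDist (P N) (m N) (load α β N) (π N)) →
        ZeroQueueingDelay k m P π →
        ∃ c : ℝ, 0 < c ∧ ∀ᶠ N : ℕ in atTop, Real.exp (c * (Real.log N / Real.log (k N))) ≤ d N) :=
  theorem4_general hα ((eventually_gt_atTop 0).mono fun _ => load_lt_one hβ)
    (isBigO_one_sub_load α β) hk hk' P hm
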